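/- For $k>0$, $c\in\mathbb{R}$ and $\varepsilon>0$ consider the travelling-wave system with cut-off \[ U'=V,\qquad V'=-cV+kUV\,H(U-\varepsilon)-U(1-U)\,H(U-\varepsilon), \] where $H(x)=0$ for $x\le 0$ and $H(x)=1$ for $x>0$. A solution on $\mathbb{R}$ is a pair $(U,V)$ with $V$ continuous, $U$ differentiable with $U'=V$ everywhere, and the second equation holding in integrated form (that is, in the sense of Carathéodory, since its right-hand side is discontinuous across $\{U=\varepsilon\}$). A heteroclinic connection between $Q^-=(1,0)$ and $Q^+=(0,0)$ is a solution on $\mathbb{R}$ with $(U,V)(\xi)\to Q^-$ as $\xi\to-\infty$ and $(U,V)(\xi)\to Q^+$ as $\xi\to+\infty$. Let \[ c(0)=c_{\rm crit}=\begin{cases}2 & \text{if } k\le 2,\\ \frac{k}{2}+\frac{2}{k} & \text{if } k>2.\end{cases} \] **Proposition.** For every $k>0$ and every $\delta>0$ there is $\varepsilon_0>0$ (depending on $k$ and $\delta$) such that for every $\varepsilon\in(0,\varepsilon_0)$ there is exactly one speed $c=c(\varepsilon)\in\mathbb{R}$ for which the system has a heteroclinic connection between $Q^-$ and $Q^+$.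 This speed satisfies $|c(\varepsilon)-c(0)|<\delta$ and $c(\varepsilon)\le c(0)$. -/

import Mathlib

open Filter Topology

namespace BurgersFKPP

/-- The Heaviside function, with the convention `H x = 0` for `x ≤ 0` and `H x = 1` for `x > 0`. -/
noncomputable def heaviside (x : ℝ) : ℝ := if 0 < x then 1 else 0

/-- The critical speed in the absence of a cut-off. -/
noncomputable def cCrit (k : ℝ) : ℝ := if k ≤ 2 then 2 else k / 2 + 2 / k

/-- The right-hand side of the `V`-equation of the travelling-wave system with cut-off. -/
noncomputable def rhsV (k c ε U V : ℝ) : ℝ :=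
  -c * V + k * U * V * heaviside (U - ε) - U * (1 - U) * heaviside (U - ε)

/-- `(U, V)` is a global solution of the travelling-wave system with Heaviside cut-off
`U' = V`, `V' = -c V + k U V H(U - ε) - U (1 - U) H(U - ε)`.
Since the right-hand side jumps across `{U = ε}`, the second equation is understood in the sense
of Carathéodory: `V` is continuous and satisfies the integrated equation. As `U` and `V` are
continuous, the integrand is measurable and bounded on bounded intervals, so the integral is
never a default value. -/
structure IsSolution (k c ε : ℝ) (U V : ℝ → ℝ) : Prop where
  continuous_V : Continuous V
  hasDerivAt_U : ∀ ξ : ℝ, HasDerivAt U (V ξ) ξ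
  integral_V : ∀ a b : ℝ, V b - V a = ∫ ξ in a..b, rhsV k c ε (U ξ) (V ξ)

/-- The travelling-wave system with cut-off has a heteroclinic connection from `Q⁻ = (1, 0)`
(as `ξ → -∞`) to `Q⁺ = (0, 0)` (as `ξ → +∞`). -/
def HasHeteroclinic (k c ε : ℝ) : Prop :=
  ∃ U V : ℝ → ℝ, IsSolution k c ε U V ∧
    Tendsto (fun ξ => (U ξ, V ξ)) atBot (𝓝 ((1 : ℝ), (0 : ℝ))) ∧
    Tendsto (fun ξ => (U ξ, V ξ)) atTop (𝓝 ((0 : ℝ), (0 : ℝ)))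

end BurgersFKPP

/-!
Reverse time, `s = -ξ`, and write `u = U`, `p = -V`. Outside the cut-off region the system becomes
`u' = p`, `p' = (c - k u) p - u (1 - u)`, and inside it is linear and conserves `V + c U`.

*Shape of a connection.* Since `(U, V) → (0, 0)`, conservation forces `V = -c U` after the last
time at which `U = ε`, whence `c > 0`, and a connection passes through `(u, p) = (ε, c ε)`
(`IsSolution.exists_exit`). Followed backwards from there, it can neither reach `p = 0` with
`u < 1`, because it would then keep `p < 0` for ever (`neg_of_neg`), nor reach the equilibrium
`(1, 0)` in finite time. So `p > 0` throughout (`pos_of_tendsto_one`), `u` is strictly monotone,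
and the connection is a graph `p = P(u)` (`HasHeteroclinic.exists_isFront`).

*Uniqueness.* If `c < c'` both admit connections, the gap `P' - P` between their graphs equals
`(c' - c) ε > 0` at `u = ε` and increases with `u`, so it cannot vanish at `u = 1`
(`IsFront.speed_not_lt`). This works for every `ε < 1`.

*Existence.* Shoot from `(ε, c ε)`. At the critical speed `a + 1 / a`, where `a = max 1 (k / 2)`,
the parabola `p = a u (1 - u)` is a lower barrier, so the orbit crosses `u = 1`
(`IsOrbitOn.gap_ge`). At a speed lower by `d` the ratio `p / u` decreases at a definite rate in
`log u` while `u` is small. If `ε` is small enough there is room on the scale `log u` for the orbit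
to reach `p = 0` when `k ≤ 2`, and to fall below the parabola `a u (1 - u)` when `k > 2`; that
parabola is then an upper barrier. In both cases the orbit cannot cross `u = 1`
(`exists_cutoff_forall_orbit_lt`). Leaving the strip through `p = 0` and leaving it through `u = 1`
are disjoint open conditions on `c`, so for some speed in between the orbit stays in the strip for
ever (`exists_hasHeteroclinic`), and it then converges to `(1, 0)`
(`tendsto_of_forall_isOrbitOn`). Global solutions and their dependence on `c` are obtained from a
truncated, globally Lipschitz vector field.
-/

namespace BurgersFKPP

open Set

/-! ### Monotonicity from derivatives -/

lemma le_of_hasDerivAt_nonneg {f f' : ℝ → ℝ} {a b : ℝ} (hab : a ≤ b)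
    (hc : ContinuousOn f (Icc a b)) (hd : ∀ s ∈ Ioo a b, HasDerivAt f (f' s) s)
    (h0 : ∀ s ∈ Ioo a b, 0 ≤ f' s) : f a ≤ f b := by
  refine monotoneOn_of_deriv_nonneg (convex_Icc a b) hc ?_ ?_ (left_mem_Icc.2 hab)
    (right_mem_Icc.2 hab) hab
  · rw [interior_Icc]
    exact fun s hs => (hd s hs).differentiableAt.differentiableWithinAt
  · rw [interior_Icc]
    intro s hs
    rw [(hd s hs).deriv]
    exact h0 s hs

lemma lt_of_hasDerivAt_pos {f f' : ℝ → ℝ} {a b : ℝ} (hab : a < b)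
    (hc : ContinuousOn f (Icc a b)) (hd : ∀ s ∈ Ioo a b, HasDerivAt f (f' s) s)
    (h0 : ∀ s ∈ Ioo a b, 0 < f' s) : f a < f b := by
  refine strictMonoOn_of_deriv_pos (convex_Icc a b) hc ?_ (left_mem_Icc.2 hab.le)
    (right_mem_Icc.2 hab.le) hab
  rw [interior_Icc]
  intro s hs
  rw [(hd s hs).deriv]
  exact h0 s hs

/-- If `f` is positive at the left end and its derivative is nonnegative wherever `f` is positive,
then `f` never falls below its initial value. -/
lemma le_of_hasDerivAt_nonneg_of_pos {f f' : ℝ → ℝ} {T : ℝ} (hT : 0 ≤ T)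
    (hc : ContinuousOn f (Icc 0 T)) (hd : ∀ s ∈ Ioo 0 T, HasDerivAt f (f' s) s)
    (h0 : 0 < f 0) (hf : ∀ s ∈ Ioo 0 T, 0 < f s → 0 ≤ f' s) : f 0 ≤ f T := by
  have hcl : IsClosed ({s | f 0 ≤ f s} ∩ Icc 0 T) := by
    have := hc.preimage_isClosed_of_isClosed isClosed_Icc (isClosed_Ici (a := f 0))
    rwa [inter_comm]
  refine hcl.Icc_subset_of_forall_exists_gt (a := 0) (b := T) (le_refl (f 0)) ?_
    (right_mem_Icc.2 hT)
  rintro x ⟨hx, hx0, hxT⟩ y hy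
  have hx' : f 0 ≤ f x := hx
  have hev : ∀ᶠ z in 𝓝[≥] x, 0 < f z := by
    have h1 : ContinuousWithinAt f (Ici x) x :=
      (hc x ⟨hx0, hxT.le⟩).mono_of_mem_nhdsWithin
        (mem_of_superset (Icc_mem_nhdsGE hxT) (Icc_subset_Icc_left hx0))
    exact h1.eventually (lt_mem_nhds (h0.trans_le hx'))
  obtain ⟨z, hz, hz'⟩ := (mem_nhdsGE_iff_exists_Icc_subset).1 hev
  have hz1 : x < z := hz
  refine ⟨min z (min y T), ?_, lt_min hz1 (lt_min hy hxT), (min_le_right _ _).trans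
    (min_le_left _ _)⟩
  have hlt : x < min z (min y T) := lt_min hz1 (lt_min hy hxT)
  have hw1 : min z (min y T) ≤ z := min_le_left _ _
  have hw2 : min z (min y T) ≤ T := (min_le_right _ _).trans (min_le_right _ _)
  refine hx'.trans (le_of_hasDerivAt_nonneg hlt.le (hc.mono (Icc_subset_Icc hx0 hw2))
    (fun s hs => hd s ⟨by linarith [hs.1], by linarith [hs.2]⟩) ?_)
  intro s hs
  exact hf s ⟨by linarith [hs.1], by linarith [hs.2]⟩ (hz' ⟨hs.1.le, by linarith [hs.2]⟩)

/-- A convergent function whose derivative converges has derivative tending to zero. -/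
lemma eq_zero_of_tendsto_of_tendsto_deriv {f f' : ℝ → ℝ} {L m : ℝ}
    (hd : ∀ s > 0, HasDerivAt f (f' s) s) (hf : Tendsto f atTop (𝓝 L))
    (hf' : Tendsto f' atTop (𝓝 m)) : m = 0 := by
  have key : ∀ n : ℕ, ∃ x ∈ Ioo ((n : ℝ) + 1) (n + 2), f' x = f (n + 2) - f (n + 1) := by
    intro n
    have hn : (0 : ℝ) ≤ n := n.cast_nonneg
    obtain ⟨x, hx, h⟩ := exists_hasDerivAt_eq_slope f f' (a := (n : ℝ) + 1) (b := n + 2)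
      (by linarith) (fun s hs => (hd s (by linarith [hs.1])).continuousAt.continuousWithinAt)
      (fun s hs => hd s (by linarith [hs.1]))
    refine ⟨x, hx, ?_⟩
    rw [h]
    have : (n : ℝ) + 2 - (n + 1) = 1 := by ring
    rw [this, div_one]
  choose x hx hxe using key
  have hn : Tendsto (fun n : ℕ => (n : ℝ)) atTop atTop := tendsto_natCast_atTop_atTop
  have hxt : Tendsto x atTop atTop :=
    tendsto_atTop_mono (fun n => by linarith [(hx n).1]) hn
  have h1 : Tendsto (fun n => f' (x n)) atTop (𝓝 m) := hf'.comp hxt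
  have h2 : Tendsto (fun n : ℕ => f (n + 2) - f (n + 1)) atTop (𝓝 (L - L)) :=
    (hf.comp (tendsto_atTop_add_const_right _ 2 hn)).sub
      (hf.comp (tendsto_atTop_add_const_right _ 1 hn))
  rw [sub_self] at h2
  refine tendsto_nhds_unique h1 (h2.congr fun n => (hxe n).symm)

/-! ### Orbits in backward time -/

/-- A pair `(u, p)` follows on `[0, T]` the travelling-wave system written in backward time
`s = -ξ` with `u = U` and `p = -V`, starting at the point `(ε, c ε)` at which a heteroclinic
connection has to enter the cut-off region. Before time `T` it stays in `p > 0`, and `u ≤ 1` up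
to time `T`. -/
structure IsOrbitOn (k c ε T : ℝ) (u p : ℝ → ℝ) : Prop where
  u_zero : u 0 = ε
  p_zero : p 0 = c * ε
  hasDerivAt_u : ∀ s ∈ Icc 0 T, HasDerivAt u (p s) s
  hasDerivAt_p : ∀ s ∈ Icc 0 T,
    HasDerivAt p ((c - k * u s) * p s - u s * (1 - u s)) s
  p_pos : ∀ s ∈ Ico 0 T, 0 < p s
  u_le_one : ∀ s ∈ Icc 0 T, u s ≤ 1

namespace IsOrbitOn

variable {k c ε T : ℝ} {u p : ℝ → ℝ}

lemma continuousOn_u (h : IsOrbitOn k c ε T u p) : ContinuousOn u (Icc 0 T) :=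
  fun s hs => (h.hasDerivAt_u s hs).continuousAt.continuousWithinAt

lemma mono (h : IsOrbitOn k c ε T u p) {s t : ℝ} (hs : 0 ≤ s) (hst : s ≤ t) (ht : t ≤ T) :
    u s ≤ u t :=
  le_of_hasDerivAt_nonneg hst (h.continuousOn_u.mono (Icc_subset_Icc hs ht))
    (fun r hr => h.hasDerivAt_u r ⟨by linarith [hr.1], by linarith [hr.2]⟩)
    (fun r hr => (h.p_pos r ⟨by linarith [hr.1], by linarith [hr.2]⟩).le)

lemma le_u (h : IsOrbitOn k c ε T u p) {s : ℝ} (hs : s ∈ Icc 0 T) : ε ≤ u s :=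
  h.u_zero ▸ h.mono le_rfl hs.1 hs.2

/-- The derivative of the gap between an orbit and the parabola `p = a u (1 - u)`. -/
lemma hasDerivAt_gap (h : IsOrbitOn k c ε T u p) (a : ℝ) {s : ℝ} (hs : s ∈ Icc 0 T) :
    HasDerivAt (fun s => p s - a * (u s * (1 - u s)))
      ((c - k * u s) * p s - u s * (1 - u s) - a * (1 - 2 * u s) * p s) s := by
  have hu := h.hasDerivAt_u s hs
  have hp := h.hasDerivAt_p s hs
  convert! hp.sub ((hu.mul (hu.const_sub 1)).const_mul a) using 1
  ring

/-- At the speed `a + 1 / a` with `k ≤ 2 a` the parabola `p = a u (1 - u)` is a lower barrier: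
the distance to it grows along every orbit. -/
lemma gap_ge (h : IsOrbitOn k c ε T u p) (hT : 0 ≤ T) (hε : 0 < ε) {a : ℝ} (ha : 0 < a)
    (hk : k ≤ 2 * a) (hc : c = a + 1 / a) :
    ε / a ≤ p T - a * (u T * (1 - u T)) := by
  have h0 : ε / a ≤ p 0 - a * (u 0 * (1 - u 0)) := by
    rw [h.u_zero, h.p_zero, hc]
    have : (a + 1 / a) * ε - a * (ε * (1 - ε)) = ε / a + a * ε ^ 2 := by ring
    rw [this]
    have : 0 ≤ a * ε ^ 2 := by positivity
    linarith
  refine h0.trans (le_of_hasDerivAt_nonneg_of_pos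
    (f := fun s => p s - a * (u s * (1 - u s))) hT
    (fun s hs => (h.hasDerivAt_gap a hs).continuousAt.continuousWithinAt)
    (fun s hs => h.hasDerivAt_gap a (Ioo_subset_Icc_self hs)) ?_ ?_)
  · exact lt_of_lt_of_le (by positivity) h0
  · intro s hs hpos
    have hs' := Ioo_subset_Icc_self hs
    have hp := h.p_pos s ⟨hs.1.le, hs.2⟩
    have hu := h.le_u hs'
    have e : (c - k * u s) * p s - u s * (1 - u s) - a * (1 - 2 * u s) * p s
        = (2 * a - k) * u s * p s + (p s - a * (u s * (1 - u s))) / a := by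
      rw [hc]; field_simp; ring
    rw [e]
    have h1 : 0 ≤ (2 * a - k) * u s * p s :=
      mul_nonneg (mul_nonneg (by linarith) (by linarith)) hp.le
    have h2 : 0 ≤ (p s - a * (u s * (1 - u s))) / a := div_nonneg hpos.le ha.le
    linarith

/-- The time the orbit spends at small `u`, measured on the scale `log u`, is bounded as long as
`p / u` decreases at a definite rate on that scale. -/
lemma log_le (h : IsOrbitOn k c ε T u p) (hε : 0 < ε) (hk : 0 ≤ k) {t b : ℝ} (hb : 0 < b)
    (ht : t ∈ Icc 0 T)
    (hin : ∀ s ∈ Ioo 0 t, (c + b) * p s * u s ≤ p s ^ 2 + u s ^ 2 * (1 - u s))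
    (hpt : 0 ≤ p t) :
    Real.log (u t) ≤ Real.log ε + c / b := by
  have hpos : ∀ s ∈ Icc 0 T, 0 < u s := fun s hs => hε.trans_le (h.le_u hs)
  have hd : ∀ s ∈ Icc 0 T, HasDerivAt (fun s => -(p s / u s + b * Real.log (u s)))
      (-((((c - k * u s) * p s - u s * (1 - u s)) * u s - p s * p s) / u s ^ 2
        + b * (p s / u s))) s := fun s hs =>
    (((h.hasDerivAt_p s hs).div (h.hasDerivAt_u s hs) (hpos s hs).ne').add
      (((h.hasDerivAt_u s hs).log (hpos s hs).ne').const_mul b)).neg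
  have key := le_of_hasDerivAt_nonneg (f := fun s => -(p s / u s + b * Real.log (u s))) ht.1
    (fun s hs => (hd s ⟨hs.1, hs.2.trans ht.2⟩).continuousAt.continuousWithinAt)
    (fun s hs => hd s ⟨hs.1.le, hs.2.le.trans ht.2⟩) (by
      intro s hs
      have hs' : s ∈ Icc 0 T := ⟨hs.1.le, hs.2.le.trans ht.2⟩
      have hu := hpos s hs'
      have hp := h.p_pos s ⟨hs.1.le, hs.2.trans_le ht.2⟩
      have e : -((((c - k * u s) * p s - u s * (1 - u s)) * u s - p s * p s) / u s ^ 2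
          + b * (p s / u s)) = (p s ^ 2 + u s ^ 2 * (1 - u s) - (c + b) * p s * u s
            + k * u s ^ 2 * p s) / u s ^ 2 := by
        field_simp; ring
      rw [e]
      have := hin s hs
      have h2 : 0 ≤ k * u s ^ 2 * p s := by positivity
      apply div_nonneg _ (by positivity)
      linarith)
  simp only [h.u_zero, h.p_zero] at key
  rw [mul_div_assoc, div_self hε.ne', mul_one] at key
  have h3 : 0 ≤ p t / u t := div_nonneg hpt (hpos t ht).le
  have h4 : b * Real.log (u t) ≤ b * (Real.log ε + c / b) := by
    rw [mul_add, mul_div_cancel₀ _ hb.ne']; linarith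
  exact le_of_mul_le_mul_left h4 hb

/-- At the speed `a + 1 / a - d` with `k = 2 a` the parabola `p = a u (1 - u)` is an upper
barrier: an orbit that is below it once falls further and further below. -/
lemma below_parabola (h : IsOrbitOn k c ε T u p) {a d : ℝ} (ha : 0 < a)
    (hd : 0 ≤ d) (hk : k = 2 * a) (hc : c = a + 1 / a - d) {t : ℝ} (ht : t ∈ Icc 0 T)
    (hle : p t ≤ a * (u t * (1 - u t))) :
    p T ≤ a * (u T * (1 - u T)) - d * (u T - u t) := by
  set D : ℝ → ℝ := fun s => p s - a * (u s * (1 - u s)) with hD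
  have hDd : ∀ s ∈ Icc 0 T, HasDerivAt D (D s / a - d * p s) s := by
    intro s hs
    convert! h.hasDerivAt_gap a hs using 1
    rw [hc, hk, hD]; field_simp; ring
  have hDc : ContinuousOn D (Icc 0 T) :=
    fun s hs => (hDd s hs).continuousAt.continuousWithinAt
  have hneg : ∀ s ∈ Icc t T, D s ≤ 0 := by
    intro s hs
    have hexp : ∀ r, HasDerivAt (fun r => Real.exp (-(r / a))) (-Real.exp (-(r / a)) / a) r := by
      intro r
      convert! (((hasDerivAt_id r).div_const a).neg).exp using 1
      simp; ring
    have := le_of_hasDerivAt_nonneg (f := fun r => -(D r * Real.exp (-(r / a))))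
      (f' := fun r => d * p r * Real.exp (-(r / a))) hs.1
      (fun r hr => ((((hDd r ⟨ht.1.trans hr.1, hr.2.trans hs.2⟩).mul
        (hexp r)).neg).continuousAt.continuousWithinAt))
      (fun r hr => by
        convert! ((hDd r ⟨ht.1.trans hr.1.le, hr.2.le.trans hs.2⟩).mul (hexp r)).neg using 1
        ring)
      (fun r hr => by
        have := h.p_pos r ⟨ht.1.trans hr.1.le, hr.2.trans_le hs.2⟩
        positivity)
    have h1 : D t * Real.exp (-(t / a)) ≤ 0 :=
      mul_nonpos_of_nonpos_of_nonneg (by simp only [hD]; linarith) (Real.exp_pos _).le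
    have h2 : D s * Real.exp (-(s / a)) ≤ 0 := by linarith
    exact nonpos_of_mul_nonpos_left h2 (Real.exp_pos _)
  have := le_of_hasDerivAt_nonneg (f := fun r => -(D r + d * u r))
      (f' := fun r => - (D r / a)) ht.2
      (fun r hr => (((hDd r ⟨ht.1.trans hr.1, hr.2⟩).add ((h.hasDerivAt_u r
        ⟨ht.1.trans hr.1, hr.2⟩).const_mul d)).neg).continuousAt.continuousWithinAt)
      (fun r hr => by
        convert! ((hDd r ⟨ht.1.trans hr.1.le, hr.2.le⟩).add ((h.hasDerivAt_u r
          ⟨ht.1.trans hr.1.le, hr.2.le⟩).const_mul d)).neg using 1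
        ring)
      (fun r hr => by
        have := hneg r (Ioo_subset_Icc_self hr)
        have := div_nonpos_of_nonpos_of_nonneg this ha.le
        linarith)
  have h0 : D t ≤ 0 := hneg t ⟨le_rfl, ht.2⟩
  simp only [hD] at this h0
  linarith

end IsOrbitOn

/-- At a speed below the critical one, and for a small cut-off, no orbit can approach `(1, 0)` or
cross `u = 1`: for `u ≥ 1 / 2` it stays below a parabola that is negative at `u = 1`. -/
lemma exists_cutoff_forall_orbit_lt {k d : ℝ} (hk : 0 < k) (hd : 0 < d) (hd1 : d ≤ 1) :
    ∃ a ε₀ : ℝ, 0 < ε₀ ∧ ε₀ ≤ 1 / 2 ∧ ∀ ε, 0 < ε → ε < ε₀ → ∀ (T : ℝ) (u p : ℝ → ℝ), 0 ≤ T →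
      IsOrbitOn k (cCrit k - d) ε T u p → 1 / 2 ≤ u T → 0 ≤ p T →
      p T ≤ a * (u T * (1 - u T)) - d * (u T - 1 / 2) := by
  set c := cCrit k - d with hc
  -- On `u ≤ η` the ratio `p / u` decreases at rate at least `d / 2` in `log u`.
  have phase : ∀ η, 0 < η → η ≤ 1 / 2 → ∀ ε, 0 < ε →
      ε < min η (η * Real.exp (-(c / (d / 2)))) → ∀ (T : ℝ) (u p : ℝ → ℝ), 0 ≤ T →
      IsOrbitOn k c ε T u p → 1 / 2 ≤ u T → 0 ≤ p T → ∃ t ∈ Icc 0 T, u t ≤ η ∧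
        p t ^ 2 + u t ^ 2 * (1 - u t) < (c + d / 2) * p t * u t := by
    intro η hη hη2 ε hε hεη T u p hT h huT hpT
    obtain ⟨h1, h2⟩ := lt_min_iff.1 hεη
    obtain ⟨t, ht, hut⟩ : η ∈ u '' Icc 0 T :=
      intermediate_value_Icc hT h.continuousOn_u ⟨by rw [h.u_zero]; exact h1.le, by linarith⟩
    by_contra! hcon
    have hpt : 0 ≤ p t := by
      rcases ht.2.lt_or_eq with hlt | heq
      · exact (h.p_pos t ⟨ht.1, hlt⟩).le
      · rw [heq]; exact hpT
    have := h.log_le hε hk.le (half_pos hd) ht (fun s hs => hcon s ⟨hs.1.le, hs.2.le.trans ht.2⟩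
      (hut ▸ h.mono hs.1.le hs.2.le ht.2)) hpt
    rw [hut] at this
    have h3 : Real.log ε < Real.log η - c / (d / 2) := by
      have := Real.log_lt_log hε h2
      rwa [Real.log_mul hη.ne' (Real.exp_pos _).ne', Real.log_exp, ← sub_eq_add_neg] at this
    linarith
  rcases le_or_gt k 2 with hk2 | hk2
  · have hcc : c = 2 - d := by rw [hc, cCrit, if_pos hk2]
    -- Here no orbit reaches `u = 1 / 2` at all, so the parabola is irrelevant: the inequality
    -- obtained from `phase` contradicts `y + (1 - u) / y ≥ 2 (1 - u)` for `y = p / u`.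
    refine ⟨0, min (d / 4) (d / 4 * Real.exp (-(c / (d / 2)))), by positivity,
      (min_le_left _ _).trans (by linarith), ?_⟩
    intro ε hε hεε T u p hT h huT hpT
    obtain ⟨t, ht, hut, hlt⟩ := phase (d / 4) (by positivity) (by linarith) ε hε hεε T u p hT h
      huT hpT
    exfalso
    have hu0 : 0 < u t := hε.trans_le (h.le_u ht)
    have hpt : 0 ≤ p t := by
      rcases ht.2.lt_or_eq with hlt | heq
      · exact (h.p_pos t ⟨ht.1, hlt⟩).le
      · rw [heq]; exact hpT
    have h1 : (c + d / 2) * (p t * u t) ≤ 2 * (1 - u t) * (p t * u t) :=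
      mul_le_mul_of_nonneg_right (by linarith) (by positivity)
    have h2 : 0 ≤ u t ^ 2 * ((1 - u t) * u t) :=
      mul_nonneg (by positivity) (mul_nonneg (by linarith) hu0.le)
    nlinarith [sq_nonneg (p t - (1 - u t) * u t)]
  · have hcc : c = k / 2 + 1 / (k / 2) - d := by
      rw [hc, cCrit, if_neg hk2.not_ge]; congr 2; field_simp
    set a := k / 2 with ha
    have ha1 : 1 < a := by rw [ha]; linarith
    have ha0 : 0 < a := by linarith
    set η := min (1 / 2) (min (1 - 1 / a ^ 2) (d / (2 * a))) with hη
    have hη0 : 0 < η := by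
      refine lt_min (by norm_num) (lt_min ?_ (by positivity))
      rw [sub_pos, div_lt_one (by positivity)]
      nlinarith
    have hη1 : η ≤ 1 - 1 / a ^ 2 := (min_le_right _ _).trans (min_le_left _ _)
    have hη2 : η ≤ d / (2 * a) := (min_le_right _ _).trans (min_le_right _ _)
    have hη3 : η ≤ 1 / 2 := min_le_left _ _
    refine ⟨a, min η (η * Real.exp (-(c / (d / 2)))), by positivity,
      (min_le_left _ _).trans hη3, ?_⟩
    intro ε hε hεε T u p hT h huT hpT
    obtain ⟨t, ht, hut, hlt⟩ := phase η hη0 hη3 ε hε hεε T u p hT h huT hpT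
    have hu0 : 0 < u t := hε.trans_le (h.le_u ht)
    have hle : p t ≤ a * (u t * (1 - u t)) := by
      by_contra! hgt
      -- `y + (1 - u) / y` is increasing in `y = p / u` for `y ≥ a (1 - u)`.
      have e1 : 1 ≤ a ^ 2 * (1 - u t) := by
        have : 1 / a ^ 2 ≤ 1 - u t := by linarith
        rw [div_le_iff₀ (by positivity)] at this
        linarith
      have e2 : a * u t ≤ d / 2 := by
        have : u t ≤ d / (2 * a) := hut.trans hη2
        rw [le_div_iff₀ (by positivity)] at this
        linarith
      have hw : 0 < 1 - u t := by linarith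
      have hp0 : 0 < p t := lt_trans (by positivity) hgt
      have hap : u t ≤ a * p t := by
        have : a * (a * (u t * (1 - u t))) ≤ a * p t := by gcongr
        nlinarith
      have e3 : 0 ≤ (p t - a * (u t * (1 - u t))) * (a * p t - u t) :=
        mul_nonneg (by linarith) (by linarith)
      have e4 : (a * (c + d / 2)) * (p t * u t) ≤ (a ^ 2 * (1 - u t) + 1) * (p t * u t) := by
        refine mul_le_mul_of_nonneg_right ?_ (by positivity)
        have : a * (c + d / 2) = a ^ 2 + 1 - a * (d / 2) := by rw [hcc]; field_simp; ring
        rw [this]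
        nlinarith
      have e5 : a * (p t ^ 2 + u t ^ 2 * (1 - u t)) < a * ((c + d / 2) * p t * u t) := by gcongr
      nlinarith
    have := h.below_parabola ha0 hd.le (by rw [ha]; ring) hcc ht hle
    have h5 : d * (u T - 1 / 2) ≤ d * (u T - u t) := by gcongr; linarith
    linarith

/-! ### Uniqueness of the speed -/

/-- A heteroclinic connection in backward time `s = -ξ`, with `u = U` and `p = -V`, translated so
that it meets the cut-off line `u = ε` at `s = 0`. The second equation is required only for `s > 0`,
where `u > ε`. -/
structure IsFront (k c ε : ℝ) (u p : ℝ → ℝ) : Prop where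
  u_zero : u 0 = ε
  p_zero : p 0 = c * ε
  hasDerivAt_u : ∀ s, HasDerivAt u (p s) s
  hasDerivAt_p : ∀ s > 0, HasDerivAt p ((c - k * u s) * p s - u s * (1 - u s)) s
  continuous_p : Continuous p
  p_pos : ∀ s, 0 < p s
  tendsto_u_atBot : Tendsto u atBot (𝓝 0)
  tendsto_u_atTop : Tendsto u atTop (𝓝 1)
  tendsto_p_atTop : Tendsto p atTop (𝓝 0)

namespace IsFront

variable {k c ε : ℝ} {u p : ℝ → ℝ}

lemma continuous_u (h : IsFront k c ε u p) : Continuous u :=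
  continuous_iff_continuousAt.2 fun s => (h.hasDerivAt_u s).continuousAt

lemma strictMono_u (h : IsFront k c ε u p) : StrictMono u :=
  strictMono_of_deriv_pos fun s => (h.hasDerivAt_u s).deriv ▸ h.p_pos s

lemma u_mem (h : IsFront k c ε u p) (s : ℝ) : u s ∈ Ioo 0 1 :=
  ⟨(h.strictMono_u.monotone.le_of_tendsto h.tendsto_u_atBot (s - 1)).trans_lt
    (h.strictMono_u (by linarith)),
   (h.strictMono_u (by linarith)).trans_le
    (h.strictMono_u.monotone.ge_of_tendsto h.tendsto_u_atTop (s + 1))⟩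

lemma exists_u_eq (h : IsFront k c ε u p) {y : ℝ} (hy : y ∈ Ioo 0 1) : ∃ s, u s = y :=
  mem_range_of_exists_le_of_exists_ge h.continuous_u
    (((h.tendsto_u_atBot.eventually (gt_mem_nhds hy.1)).exists).imp fun _ h => h.le)
    (((h.tendsto_u_atTop.eventually (lt_mem_nhds hy.2)).exists).imp fun _ h => h.le)

/-- The inverse of the profile `u` has derivative `1 / p`. -/
lemma hasDerivAt_invFun (h : IsFront k c ε u p) {y : ℝ} (hy : y ∈ Ioo 0 1) :
    HasDerivAt (Function.invFun u) (p (Function.invFun u y))⁻¹ y := by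
  have hr : ∀ y ∈ Ioo (0 : ℝ) 1, u (Function.invFun u y) = y := fun y hy =>
    Function.invFun_eq (h.exists_u_eq hy)
  have hl : ∀ s, Function.invFun u (u s) = s :=
    Function.leftInverse_invFun h.strictMono_u.injective
  have hmono : StrictMonoOn (Function.invFun u) (Ioo 0 1) := by
    intro a ha b hb hab
    rw [← h.strictMono_u.lt_iff_lt, hr a ha, hr b hb]
    exact hab
  have himg : Function.invFun u '' Ioo 0 1 = univ :=
    eq_univ_of_forall fun s => ⟨u s, h.u_mem s, hl s⟩
  refine HasDerivAt.of_local_left_inverse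
    (hmono.continuousAt_of_image_mem_nhds (isOpen_Ioo.mem_nhds hy) (himg ▸ univ_mem))
    (h.hasDerivAt_u _) (h.p_pos _).ne' ?_
  filter_upwards [isOpen_Ioo.mem_nhds hy] with z hz using hr z hz

/-- Two fronts with different speeds cannot coexist. Written as graphs `p = P(u)`, the faster one
starts above the slower one on the line `u = ε`, and the gap between the two increases with `u`,
although both graphs end in `(1, 0)`. -/
lemma speed_not_lt {c' : ℝ} {u' p' : ℝ → ℝ} (h : IsFront k c ε u p) (h' : IsFront k c' ε u' p')
    (hε : 0 < ε) : ¬ c < c' := by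
  intro hcc
  set g := Function.invFun u with hg
  have hr : ∀ s, u (g (u' s)) = u' s := fun s =>
    Function.invFun_eq (h.exists_u_eq (h'.u_mem s))
  set D : ℝ → ℝ := fun s => p' s - p (g (u' s)) with hD
  have hgd : ∀ s, HasDerivAt (fun s => g (u' s)) ((p (g (u' s)))⁻¹ * p' s) s := fun s =>
    (h.hasDerivAt_invFun (h'.u_mem s)).comp s (h'.hasDerivAt_u s)
  have hgpos : ∀ s > 0, 0 < g (u' s) := by
    intro s hs
    rw [← h.strictMono_u.lt_iff_lt, hr, h.u_zero, ← h'.u_zero]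
    exact h'.strictMono_u hs
  have hg0 : g (u' 0) = 0 := by
    apply h.strictMono_u.injective
    rw [hr, h.u_zero, h'.u_zero]
  have hDc : Continuous D := h'.continuous_p.sub (h.continuous_p.comp
    (continuous_iff_continuousAt.2 fun s => (hgd s).continuousAt))
  have hDd : ∀ s > 0, HasDerivAt D
      ((c' - c) * p' s + u' s * (1 - u' s) * D s / p (g (u' s))) s := by
    intro s hs
    have h1 := h.hasDerivAt_p _ (hgpos s hs)
    convert! (h'.hasDerivAt_p s hs).sub (h1.comp s (hgd s)) using 1
    have := (h.p_pos (g (u' s))).ne'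
    simp only [hD]
    rw [hr]
    field_simp
    ring
  have hD0 : D 0 = (c' - c) * ε := by
    simp only [hD]; rw [hg0, h.p_zero, h'.p_zero]; ring
  have hD0' : 0 < D 0 := by rw [hD0]; exact mul_pos (by linarith) hε
  have hge : ∀ T ≥ 0, D 0 ≤ D T := by
    intro T hT
    refine le_of_hasDerivAt_nonneg_of_pos hT hDc.continuousOn (fun s hs => hDd s hs.1) hD0' ?_
    intro s hs hpos
    have h1 := h'.p_pos s
    have h2 := h'.u_mem s
    have h3 := h.p_pos (g (u' s))
    have h4 : 0 ≤ (c' - c) * p' s := mul_nonneg (by linarith) h1.le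
    have h5 : 0 ≤ u' s * (1 - u' s) * D s / p (g (u' s)) :=
      div_nonneg (mul_nonneg (mul_nonneg h2.1.le (by linarith [h2.2])) hpos.le) h3.le
    linarith
  have hgt : Tendsto (fun s => g (u' s)) atTop atTop := by
    refine tendsto_atTop.2 fun M => ?_
    filter_upwards [h'.tendsto_u_atTop.eventually (lt_mem_nhds (h.u_mem M).2)] with s hs
    rw [← hr s, h.strictMono_u.lt_iff_lt] at hs
    exact hs.le
  have hlim : Tendsto D atTop (𝓝 (0 - 0)) :=
    h'.tendsto_p_atTop.sub (h.tendsto_p_atTop.comp hgt)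
  have : D 0 ≤ 0 - 0 :=
    ge_of_tendsto hlim ((eventually_ge_atTop 0).mono hge)
  linarith

end IsFront

/-! ### First exit times and the equilibrium `(1, 0)` -/

lemma exists_first_zero {f : ℝ → ℝ} {a b : ℝ} (hf : ContinuousOn f (Icc a b)) (hab : a ≤ b)
    (ha : 0 < f a) (hb : f b ≤ 0) : ∃ s ∈ Ioc a b, f s = 0 ∧ ∀ t ∈ Ico a s, 0 < f t := by
  have hcl : IsClosed (Icc a b ∩ f ⁻¹' Iic 0) :=
    hf.preimage_isClosed_of_isClosed isClosed_Icc isClosed_Iic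
  obtain ⟨s, ⟨hs, hs0⟩, hmin⟩ :=
    (isCompact_Icc.of_isClosed_subset hcl inter_subset_left).exists_isLeast
    ⟨b, right_mem_Icc.2 hab, hb⟩
  have hs0' : f s ≤ 0 := hs0
  have hlt : ∀ t ∈ Ico a s, 0 < f t := by
    intro t ht
    by_contra! hcon
    exact absurd (hmin ⟨⟨ht.1, ht.2.le.trans hs.2⟩, hcon⟩) (not_le.2 ht.2)
  have has : a < s := lt_of_le_of_ne hs.1 (by rintro rfl; linarith)
  refine ⟨s, ⟨has, hs.2⟩, le_antisymm hs0' ?_, hlt⟩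
  have hc : Tendsto f (𝓝[Ico a s] s) (𝓝 (f s)) :=
    (hf s hs).mono (fun t ht => ⟨ht.1, ht.2.le.trans hs.2⟩)
  have : (𝓝[Ico a s] s).NeBot := by
    rw [← mem_closure_iff_nhdsWithin_neBot, closure_Ico has.ne]
    exact ⟨has.le, le_rfl⟩
  exact ge_of_tendsto hc (eventually_mem_nhdsWithin.mono fun t ht => (hlt t ht).le)

lemma eventually_sign_of_hasDerivAt_neg {f : ℝ → ℝ} {m x : ℝ} (hf : HasDerivAt f m x)
    (hm : m < 0) (hx : f x = 0) :
    (∀ᶠ y in 𝓝[>] x, f y < 0) ∧ ∀ᶠ y in 𝓝[<] x, 0 < f y := by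
  have h := eventually_nhdsWithin_sign_eq_of_deriv_neg (hf.deriv.symm ▸ hm) hx
  constructor
  · filter_upwards [nhdsWithin_le_nhds h, self_mem_nhdsWithin] with y hy hy'
    have hxy : x < y := hy'
    rw [sign_neg (by linarith : x - y < 0)] at hy
    exact sign_eq_neg_one_iff.1 hy
  · filter_upwards [nhdsWithin_le_nhds h, self_mem_nhdsWithin] with y hy hy'
    have hxy : y < x := hy'
    rw [sign_pos (by linarith : 0 < x - y)] at hy
    exact sign_eq_one_iff.1 hy

/-- The equilibrium `(1, 0)` is not reached in finite time from within the strip: near it the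
squared distance `(1 - u) ^ 2 + p ^ 2` decays at most exponentially. -/
lemma eq_one_of_reaches_equilibrium {k c a b : ℝ} {u p : ℝ → ℝ} (hk : 0 ≤ k) (hc : 0 ≤ c)
    (hab : a ≤ b) (hu : ContinuousOn u (Icc a b)) (hp : ContinuousOn p (Icc a b))
    (hud : ∀ s ∈ Ioo a b, HasDerivAt u (p s) s)
    (hpd : ∀ s ∈ Ioo a b, HasDerivAt p ((c - k * u s) * p s - u s * (1 - u s)) s)
    (hu01 : ∀ s ∈ Ioo a b, u s ∈ Icc 0 1) (hp0 : ∀ s ∈ Ioo a b, 0 ≤ p s)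
    (hub : u b = 1) (hpb : p b = 0) : u a = 1 := by
  set K := 2 + 2 * k with hK
  have hexp : ∀ s, HasDerivAt (fun s => Real.exp (K * s)) (K * Real.exp (K * s)) s := by
    intro s
    convert! ((hasDerivAt_id s).const_mul K).exp using 1
    simp; ring
  have key := le_of_hasDerivAt_nonneg
    (f := fun s => ((1 - u s) ^ 2 + p s ^ 2) * Real.exp (K * s))
    (f' := fun s => (-(2 * (1 - u s) * p s) + 2 * p s * ((c - k * u s) * p s - u s * (1 - u s))
      + K * ((1 - u s) ^ 2 + p s ^ 2)) * Real.exp (K * s)) hab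
    (by fun_prop)
    (fun s hs => by
      convert! ((((hud s hs).const_sub 1).pow 2).add ((hpd s hs).pow 2)).mul (hexp s) using 1
      simp; ring)
    (fun s hs => by
      obtain ⟨h0, h1⟩ := hu01 s hs
      have h2 := hp0 s hs
      refine mul_nonneg ?_ (Real.exp_pos _).le
      have e1 : 0 ≤ c * p s ^ 2 := by positivity
      have e2 : 0 ≤ k * ((1 - u s) * p s ^ 2) :=
        mul_nonneg hk (mul_nonneg (by linarith) (by positivity))
      have e3 : 0 ≤ k * (1 - u s) ^ 2 := by positivity
      have e4 : 0 ≤ (1 - u s) * ((1 - u s) * p s) :=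
        mul_nonneg (by linarith) (mul_nonneg (by linarith) h2)
      nlinarith [sq_nonneg (1 - u s - p s)])
  simp only [hub, hpb, sub_self, ne_eq, OfNat.ofNat_ne_zero, not_false_eq_true, zero_pow,
    add_zero, zero_mul] at key
  have h1 : (1 - u a) ^ 2 + p a ^ 2 ≤ 0 := nonpos_of_mul_nonpos_left key (Real.exp_pos _)
  nlinarith [sq_nonneg (1 - u a), sq_nonneg (p a)]

/-! ### Every heteroclinic connection is a front -/

namespace IsSolution

variable {k c ε : ℝ} {U V : ℝ → ℝ}

lemma continuous_U (h : IsSolution k c ε U V) : Continuous U :=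
  continuous_iff_continuousAt.2 fun s => (h.hasDerivAt_U s).continuousAt

/-- In the cut-off region the system is linear and `V + c U` is conserved. -/
lemma sub_eq_of_le (h : IsSolution k c ε U V) {a b : ℝ} (hab : a ≤ b)
    (hU : ∀ s ∈ Icc a b, U s ≤ ε) : V b - V a = -c * (U b - U a) := by
  rw [h.integral_V a b, ← intervalIntegral.integral_eq_sub_of_hasDerivAt
    (fun s _ => h.hasDerivAt_U s) (h.continuous_V.intervalIntegrable a b),
    ← intervalIntegral.integral_const_mul]
  refine intervalIntegral.integral_congr fun s hs => ?_
  rw [uIcc_of_le hab] at hs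
  have : ¬ 0 < U s - ε := by linarith [hU s hs]
  simp [rhsV, heaviside, this]

/-- Outside the cut-off region the `V`-equation holds in the classical sense. -/
lemma hasDerivAt_V (h : IsSolution k c ε U V) {ξ : ℝ} (hξ : ε < U ξ) :
    HasDerivAt V (-c * V ξ + k * U ξ * V ξ - U ξ * (1 - U ξ)) ξ := by
  have hU := h.continuous_U
  have hV := h.continuous_V
  have hopen : IsOpen {s | ε < U s} := isOpen_lt continuous_const hU
  have heq : ∀ s, ε < U s → rhsV k c ε (U s) (V s)
      = -c * V s + k * U s * V s - U s * (1 - U s) := by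
    intro s hs
    have : 0 < U s - ε := by linarith
    simp [rhsV, heaviside, this]
  have hcont : ContinuousOn (fun s => rhsV k c ε (U s) (V s)) {s | ε < U s} :=
    ContinuousOn.congr (f := fun s => -c * V s + k * U s * V s - U s * (1 - U s))
      (by fun_prop) (fun s hs => heq s hs)
  have := intervalIntegral.integral_hasDerivAt_right (a := ξ) (b := ξ)
    (IntervalIntegrable.refl (f := fun s => rhsV k c ε (U s) (V s)))
    (hcont.stronglyMeasurableAtFilter hopen ξ hξ) (hcont.continuousAt (hopen.mem_nhds hξ))
  rw [heq ξ hξ] at this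
  refine (this.const_add (V ξ)).congr_of_eventuallyEq (Eventually.of_forall fun s => ?_)
  simp only
  rw [← h.integral_V ξ s]; ring

end IsSolution

/-- A heteroclinic connection leaves `u ≥ ε` at a last time, and from then on it is the explicit
exponential decaying solution of the linear system; in particular its speed is positive. -/
lemma IsSolution.exists_exit {k c ε : ℝ} {U V : ℝ → ℝ} (h : IsSolution k c ε U V) (hε : 0 < ε)
    (hε1 : ε < 1) (hbot : Tendsto U atBot (𝓝 1)) (htop : Tendsto U atTop (𝓝 0))
    (hVtop : Tendsto V atTop (𝓝 0)) :
    0 < c ∧ ∃ ξ₁, U ξ₁ = ε ∧ ∀ ξ ≥ ξ₁, 0 < U ξ ∧ V ξ = -c * U ξ := by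
  set S := {ξ | ε ≤ U ξ} with hS
  have hcl : IsClosed S := isClosed_le continuous_const h.continuous_U
  have hne : S.Nonempty := ((hbot.eventually (lt_mem_nhds hε1)).exists).imp fun _ h => h.le
  have hbdd : BddAbove S := by
    obtain ⟨B, hB⟩ := eventually_atTop.1 (htop.eventually (gt_mem_nhds hε))
    refine ⟨B, fun s hs => ?_⟩
    by_contra! hcon
    exact absurd (hB s hcon.le) (not_lt.2 hs)
  set ξ₁ := sSup S with hξ₁
  have hmem : ε ≤ U ξ₁ := hcl.csSup_mem hne hbdd
  have hlt : ∀ ξ > ξ₁, U ξ < ε := by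
    intro ξ hξ
    by_contra! hcon
    exact absurd (le_csSup hbdd hcon) (not_le.2 hξ)
  have hUξ : U ξ₁ = ε := by
    refine le_antisymm ?_ hmem
    exact le_of_tendsto (h.continuous_U.continuousAt.mono_left nhdsWithin_le_nhds)
      (eventually_mem_nhdsWithin.mono fun ξ (hξ : ξ ∈ Ioi ξ₁) => (hlt ξ hξ).le)
  have hle : ∀ ξ ≥ ξ₁, U ξ ≤ ε := by
    intro ξ hξ
    rcases hξ.lt_or_eq with h1 | h1
    · exact (hlt ξ h1).le
    · rw [← h1, hUξ]
  have hcons : ∀ ξ ≥ ξ₁, V ξ - V ξ₁ = -c * (U ξ - U ξ₁) := fun ξ hξ =>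
    h.sub_eq_of_le hξ fun s hs => hle s hs.1
  have hlim : 0 - V ξ₁ = -c * (0 - U ξ₁) :=
    tendsto_nhds_unique (hVtop.sub_const _)
      (((htop.sub_const (U ξ₁)).const_mul (-c)).congr' ((eventually_ge_atTop ξ₁).mono
        fun ξ hξ => (hcons ξ hξ).symm))
  have hV : ∀ ξ ≥ ξ₁, V ξ = -c * U ξ := fun ξ hξ => by
    have := hcons ξ hξ
    linarith
  have hexp : ∀ ξ ≥ ξ₁, U ξ * Real.exp (c * (ξ - ξ₁)) = ε := by
    intro ξ hξ
    have hd : ∀ s, HasDerivAt (fun s => U s * Real.exp (c * (s - ξ₁)))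
        ((V s + c * U s) * Real.exp (c * (s - ξ₁))) s := by
      intro s
      convert! (h.hasDerivAt_U s).mul ((((hasDerivAt_id s).sub_const ξ₁).const_mul c).exp) using 1
      simp; ring
    have := constant_of_has_deriv_right_zero (a := ξ₁) (b := ξ)
      (f := fun s => U s * Real.exp (c * (s - ξ₁)))
      (fun s _ => (hd s).continuousAt.continuousWithinAt) (fun s hs => by
        have h1 := hd s
        rw [hV s hs.1] at h1
        convert! h1.hasDerivWithinAt using 1
        ring) ξ ⟨hξ, le_rfl⟩
    simpa [hUξ] using this
  refine ⟨?_, ξ₁, hUξ, fun ξ hξ => ⟨?_, hV ξ hξ⟩⟩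
  · by_contra! hc
    have h1 := hexp (ξ₁ + 1) (by linarith)
    have h2 := hlt (ξ₁ + 1) (by linarith)
    have h3 : Real.exp (c * (ξ₁ + 1 - ξ₁)) ≤ 1 := by
      rw [Real.exp_le_one_iff]; linarith
    have h4 := Real.exp_pos (c * (ξ₁ + 1 - ξ₁))
    nlinarith
  · have h1 := hexp ξ hξ
    have h4 := Real.exp_pos (c * (ξ - ξ₁))
    exact pos_of_mul_pos_left (h1 ▸ hε) h4.le

/-- In backward time a solution that has `u < 1` and `p < 0` keeps `p < 0` for ever. The two
hypotheses on `p` express the system above and below the cut-off line. -/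
lemma neg_of_neg {k c ε : ℝ} {u p : ℝ → ℝ} (hc : 0 < c) (hε : 0 < ε)
    (hu : ∀ s, HasDerivAt u (p s) s) (hpc : Continuous p)
    (hp : ∀ s, ε < u s → HasDerivAt p ((c - k * u s) * p s - u s * (1 - u s)) s)
    (hlin : ∀ a b, a ≤ b → (∀ s ∈ Icc a b, u s ≤ ε) → p b - p a = c * (u b - u a))
    {s₀ : ℝ} (hps : p s₀ < 0) (hus : u s₀ < 1) {s : ℝ} (hs : s₀ ≤ s) : p s < 0 := by
  have huc : Continuous u := continuous_iff_continuousAt.2 fun s => (hu s).continuousAt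
  by_contra! hcon
  obtain ⟨t, ht, hpt, hneg⟩ := exists_first_zero (f := fun s => -p s) (by fun_prop) hs
    (by linarith) (by linarith)
  have hpt' : p t = 0 := by linarith
  have hanti : ∀ a b, s₀ ≤ a → a < b → b ≤ t → u b < u a := by
    intro a b ha hab hb
    have := lt_of_hasDerivAt_pos (f := fun s => -u s) hab (by fun_prop)
      (fun r _ => (hu r).neg) (fun r hr => hneg r ⟨by linarith [hr.1], by linarith [hr.2]⟩)
    linarith
  rcases lt_or_ge (u t) ε with hut | hut
  · -- The zero of `p` would be reached inside the linear region, where `p - c u` is conserved.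
    have hev : ∀ᶠ r in 𝓝[<] t, u r < ε ∧ r ∈ Ioo s₀ t :=
      ((huc.continuousAt.eventually (gt_mem_nhds hut)).filter_mono nhdsWithin_le_nhds).and
        (Ioo_mem_nhdsLT ht.1)
    obtain ⟨r, hr, hr'⟩ := hev.exists
    have h1 := hlin r t hr'.2.le (fun s hs => by
      rcases hs.1.eq_or_lt with h | h
      · rw [← h]; exact hr.le
      · exact ((hanti r s hr'.1.le h hs.2).trans hr).le)
    have h2 := hneg r ⟨hr'.1.le, hr'.2⟩
    have h3 := hanti r t hr'.1.le hr'.2 le_rfl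
    nlinarith
  · -- The zero of `p` would be reached from outside the cut-off region with `p` decreasing.
    have hut1 : u t < 1 := (hanti s₀ t le_rfl ht.1 le_rfl).trans hus
    have hval : (c - k * u t) * p t - u t * (1 - u t) < 0 := by
      rw [hpt']
      have : 0 < u t * (1 - u t) := mul_pos (by linarith) (by linarith)
      linarith
    have hcont : Continuous fun r => (c - k * u r) * p r - u r * (1 - u r) := by fun_prop
    obtain ⟨r, hr, hr'⟩ := (mem_nhdsLT_iff_exists_Ioo_subset' ht.1).1
      ((hcont.continuousAt.eventually (gt_mem_nhds hval)).filter_mono nhdsWithin_le_nhds)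
    have hr1 : r < t := hr
    set q := max r s₀ with hq
    have hqt : q < t := max_lt hr1 ht.1
    have := lt_of_hasDerivAt_pos (f := fun s => -p s) hqt (by fun_prop)
      (fun s hs => (hp s (hut.trans_lt
        (hanti s t ((le_max_right _ _).trans hs.1.le) hs.2 le_rfl))).neg)
      (fun s hs => by
        have : (c - k * u s) * p s - u s * (1 - u s) < 0 :=
          hr' ⟨(le_max_left _ _).trans_lt hs.1, hs.2⟩
        linarith)
    have h2 := hneg q ⟨le_max_right _ _, hqt⟩
    linarith

/-- In backward time a solution that starts on the cut-off line with `p > 0` and tends to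
`u = 1` can never reach `p = 0`. -/
lemma pos_of_tendsto_one {k c ε : ℝ} {u p : ℝ → ℝ} (hk : 0 ≤ k) (hc : 0 < c) (hε : 0 < ε)
    (hε1 : ε < 1)
    (hu : ∀ s, HasDerivAt u (p s) s) (hpc : Continuous p)
    (hp : ∀ s, ε < u s → HasDerivAt p ((c - k * u s) * p s - u s * (1 - u s)) s)
    (hlin : ∀ a b, a ≤ b → (∀ s ∈ Icc a b, u s ≤ ε) → p b - p a = c * (u b - u a))
    (hu0 : u 0 = ε) (hp0 : 0 < p 0) (hlim : Tendsto u atTop (𝓝 1)) {s : ℝ} (hs : 0 ≤ s) :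
    0 < p s := by
  have huc : Continuous u := continuous_iff_continuousAt.2 fun s => (hu s).continuousAt
  by_contra! hcon
  obtain ⟨t, ht, hpt, hpos⟩ := exists_first_zero hpc.continuousOn hs hp0 hcon
  have hmono : ∀ a b, 0 ≤ a → a < b → b ≤ t → u a < u b := fun a b ha hab hb =>
    lt_of_hasDerivAt_pos hab huc.continuousOn (fun r _ => hu r)
      (fun r hr => hpos r ⟨by linarith [hr.1], by linarith [hr.2]⟩)
  have hεu : ∀ s, 0 < s → s ≤ t → ε < u s := fun s h0 h1 => hu0 ▸ hmono 0 s le_rfl h0 h1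
  have hut := hεu t ht.1 le_rfl
  have hpd := hp t hut
  rw [hpt, mul_zero, zero_sub] at hpd
  rcases lt_trichotomy (u t) 1 with h1 | h1 | h1
  · have hneg : -(u t * (1 - u t)) < 0 := by
      have : 0 < u t * (1 - u t) := mul_pos (by linarith) (by linarith)
      linarith
    have hev := (eventually_sign_of_hasDerivAt_neg hpd hneg hpt).1.and
      ((huc.continuousAt.eventually (gt_mem_nhds h1)).filter_mono nhdsWithin_le_nhds)
    obtain ⟨r, hr, hr1⟩ := hev.exists
    have hanti : ∀ s ≥ r, u s ≤ u r := by
      intro s hs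
      have := le_of_hasDerivAt_nonneg (f := fun s => -u s) hs (by fun_prop)
        (fun q _ => (hu q).neg) (fun q hq => by
          have := neg_of_neg hc hε hu hpc hp hlin hr hr1 hq.1.le
          linarith)
      linarith
    have := le_of_tendsto hlim ((eventually_ge_atTop r).mono hanti)
    linarith
  · have := eq_one_of_reaches_equilibrium hk hc.le ht.1.le huc.continuousOn hpc.continuousOn
      (fun s _ => hu s) (fun s hs => hp s (hεu s hs.1 hs.2.le))
      (fun s hs => ⟨(hε.trans (hεu s hs.1 hs.2.le)).le,
        h1 ▸ (hmono s t hs.1.le hs.2 le_rfl).le⟩)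
      (fun s hs => (hpos s ⟨hs.1.le, hs.2⟩).le) h1 hpt
    linarith
  · have hneg : -(-(u t * (1 - u t))) < 0 := by
      have : 0 < u t * (u t - 1) := mul_pos (by linarith) (by linarith)
      linarith
    have hev := (eventually_sign_of_hasDerivAt_neg (f := fun s => -p s) hpd.neg hneg
      (by simp [hpt])).2.and (Ioo_mem_nhdsLT ht.1)
    obtain ⟨r, hr, hr'⟩ := hev.exists
    have := hpos r ⟨hr'.1.le, hr'.2⟩
    linarith

lemma HasHeteroclinic.exists_isFront {k c ε : ℝ} (h : HasHeteroclinic k c ε) (hk : 0 ≤ k)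
    (hε : 0 < ε) (hε1 : ε < 1) : ∃ u p : ℝ → ℝ, IsFront k c ε u p := by
  obtain ⟨U, V, hsol, hbot, htop⟩ := h
  rw [nhds_prod_eq, tendsto_prod_iff'] at hbot htop
  obtain ⟨hc, ξ₁, hξ₁, hafter⟩ := hsol.exists_exit hε hε1 hbot.1 htop.1 htop.2
  have hdsub : ∀ s, HasDerivAt (fun s => ξ₁ - s) (-1) s := fun s =>
    (hasDerivAt_id s).const_sub ξ₁
  have hatBot : Tendsto (fun s => ξ₁ - s) atTop atBot :=
    tendsto_atBot_add_const_left _ ξ₁ tendsto_neg_atTop_atBot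
  have hatTop : Tendsto (fun s => ξ₁ - s) atBot atTop :=
    tendsto_atTop_add_const_left _ ξ₁ tendsto_neg_atBot_atTop
  set u : ℝ → ℝ := fun s => U (ξ₁ - s) with hudef
  set p : ℝ → ℝ := fun s => -V (ξ₁ - s) with hpdef
  have hu : ∀ s, HasDerivAt u (p s) s := by
    intro s
    convert! (hsol.hasDerivAt_U (ξ₁ - s)).comp s (hdsub s) using 1
    simp [hpdef]
  have hpc : Continuous p := (hsol.continuous_V.comp (by fun_prop)).neg
  have hp : ∀ s, ε < u s → HasDerivAt p ((c - k * u s) * p s - u s * (1 - u s)) s := by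
    intro s hs
    convert! ((hsol.hasDerivAt_V hs).comp s (hdsub s)).neg using 1
    simp only [hudef, hpdef]; ring
  have hlin : ∀ a b, a ≤ b → (∀ s ∈ Icc a b, u s ≤ ε) → p b - p a = c * (u b - u a) := by
    intro a b hab hle
    have := hsol.sub_eq_of_le (a := ξ₁ - b) (b := ξ₁ - a) (by linarith) (fun s hs => by
      have := hle (ξ₁ - s) ⟨by linarith [hs.2], by linarith [hs.1]⟩
      simpa [hudef] using this)
    simp only [hudef, hpdef]
    linarith
  have hu0 : u 0 = ε := by simp [hudef, hξ₁]
  have hneg : ∀ s ≤ 0, p s = c * u s ∧ 0 < u s := by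
    intro s hs
    obtain ⟨h1, h2⟩ := hafter (ξ₁ - s) (by linarith)
    refine ⟨?_, h1⟩
    simp only [hpdef, h2]; ring
  have hp0 : p 0 = c * ε := by rw [(hneg 0 le_rfl).1, hu0]
  have hlim : Tendsto u atTop (𝓝 1) := hbot.1.comp hatBot
  have hpos : ∀ s, 0 < p s := by
    intro s
    rcases le_total s 0 with h | h
    · rw [(hneg s h).1]; exact mul_pos hc (hneg s h).2
    · exact pos_of_tendsto_one hk hc hε hε1 hu hpc hp hlin hu0 (by rw [hp0]; positivity) hlim h
  refine ⟨u, p, hu0, hp0, hu, fun s hs => hp s ?_, hpc, hpos, htop.1.comp hatTop, hlim, ?_⟩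
  · have : StrictMono u := strictMono_of_deriv_pos fun s => (hu s).deriv ▸ hpos s
    exact hu0 ▸ this hs
  · simpa using (hbot.2.comp hatBot).neg

/-! ### From positive orbits to heteroclinic connections -/

lemma exists_tendsto_of_monotone_on_Ici {f : ℝ → ℝ} {B : ℝ}
    (hf : ∀ s t, 0 ≤ s → s ≤ t → f s ≤ f t) (hB : ∀ s ≥ 0, f s ≤ B) :
    ∃ L, Tendsto f atTop (𝓝 L) := by
  have hm : Monotone fun s => f (max 0 s) := fun s t hst =>
    hf _ _ (le_max_left _ _) (max_le_max le_rfl hst)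
  refine ⟨_, (tendsto_atTop_ciSup hm ⟨B, ?_⟩).congr' ?_⟩
  · rintro _ ⟨s, rfl⟩
    exact hB _ (le_max_left _ _)
  · filter_upwards [eventually_ge_atTop 0] with s hs
    rw [max_eq_right hs]

/-- An orbit that stays in the strip for all backward times tends to `(1, 0)`: besides `u`, the
function `p - c u + k u ^ 2 / 2`, whose derivative is `-u (1 - u)`, is monotone and bounded, and
the limit has to be an equilibrium. -/
lemma tendsto_of_forall_isOrbitOn {k c ε : ℝ} {u p : ℝ → ℝ} (hk : 0 ≤ k) (hc : 0 ≤ c)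
    (hε : 0 < ε) (h : ∀ T, IsOrbitOn k c ε T u p) :
    Tendsto u atTop (𝓝 1) ∧ Tendsto p atTop (𝓝 0) := by
  have hu1 : ∀ s ≥ 0, u s ≤ 1 := fun s hs => (h s).u_le_one s ⟨hs, le_rfl⟩
  have huε : ∀ s ≥ 0, ε ≤ u s := fun s hs => (h s).le_u ⟨hs, le_rfl⟩
  have hp : ∀ s ≥ 0, 0 < p s := fun s hs => (h (s + 1)).p_pos s ⟨hs, by linarith⟩
  have hud : ∀ s ≥ 0, HasDerivAt u (p s) s := fun s hs => (h s).hasDerivAt_u s ⟨hs, le_rfl⟩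
  have hpd : ∀ s ≥ 0, HasDerivAt p ((c - k * u s) * p s - u s * (1 - u s)) s :=
    fun s hs => (h s).hasDerivAt_p s ⟨hs, le_rfl⟩
  obtain ⟨L, hL⟩ := exists_tendsto_of_monotone_on_Ici (f := u) (B := 1)
    (fun s t hs hst => (h t).mono hs hst le_rfl) hu1
  have hqd : ∀ s ≥ 0, HasDerivAt (fun s => -(p s - c * u s + k * u s ^ 2 / 2))
      (u s * (1 - u s)) s := by
    intro s hs
    convert! (((hpd s hs).sub ((hud s hs).const_mul c)).add
      ((((hud s hs).pow 2).const_mul k).div_const 2)).neg using 1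
    simp; ring
  obtain ⟨m, hm⟩ := exists_tendsto_of_monotone_on_Ici
    (f := fun s => -(p s - c * u s + k * u s ^ 2 / 2)) (B := c)
    (fun s t hs hst => le_of_hasDerivAt_nonneg
      (f := fun s => -(p s - c * u s + k * u s ^ 2 / 2)) hst
      (fun r hr => (hqd r (hs.trans hr.1)).continuousAt.continuousWithinAt)
      (fun r hr => hqd r (hs.trans hr.1.le))
      (fun r hr => mul_nonneg (hε.le.trans (huε r (hs.trans hr.1.le)))
        (by linarith [hu1 r (hs.trans hr.1.le)])))
    (fun s hs => by
      have h1 : c * u s ≤ c * 1 := by gcongr; exact hu1 s hs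
      have h2 : 0 ≤ k * u s ^ 2 / 2 := by positivity
      linarith [hp s hs])
  have hpl : Tendsto p atTop (𝓝 (-m + c * L - k * L ^ 2 / 2)) := by
    refine ((hm.neg.add (hL.const_mul c)).sub (((hL.pow 2).const_mul k).div_const 2)).congr ?_
    intro s; ring
  have hp0 := eq_zero_of_tendsto_of_tendsto_deriv (fun s hs => hud s hs.le) hL hpl
  have hu0 := eq_zero_of_tendsto_of_tendsto_deriv (fun s hs => hqd s hs.le) hm
    (hL.mul (hL.const_sub 1))
  have hLε : ε ≤ L := ge_of_tendsto hL ((eventually_ge_atTop 0).mono huε)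
  have hL1 : L = 1 := by
    rcases mul_eq_zero.1 hu0 with h1 | h1 <;> linarith
  rw [hp0] at hpl
  rw [hL1] at hL
  exact ⟨hL, hpl⟩

lemma hasDerivAt_ite_le {f g : ℝ → ℝ} {m : ℝ} (hfg : f 0 = g 0) (hf : HasDerivAt f m 0)
    (hg : HasDerivAt g m 0) : HasDerivAt (fun x => if x ≤ 0 then f x else g x) m 0 := by
  rw [← hasDerivWithinAt_univ, ← Iic_union_Ici (a := (0 : ℝ))]
  refine HasDerivWithinAt.union ?_ ?_
  · exact hf.hasDerivWithinAt.congr (fun x hx => if_pos hx) (if_pos le_rfl)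
  · refine hg.hasDerivWithinAt.congr (fun x hx => ?_) (by simp [hfg])
    rcases (mem_Ici.1 hx).eq_or_lt with h | h
    · simp [← h, hfg]
    · exact if_neg h.not_ge

lemma intervalIntegrable_rhsV {k c ε : ℝ} {U V : ℝ → ℝ} (hU : Continuous U) (hV : Continuous V)
    (a b : ℝ) :
    IntervalIntegrable (fun ξ => rhsV k c ε (U ξ) (V ξ)) MeasureTheory.volume a b := by
  have hm : MeasurableSet {ξ | ε < U ξ} := (isOpen_lt continuous_const hU).measurableSet
  have h1 : IntervalIntegrable (fun ξ => -c * V ξ) MeasureTheory.volume a b :=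
    Continuous.intervalIntegrable (by fun_prop) a b
  have h2 : IntervalIntegrable (fun ξ => k * U ξ * V ξ - U ξ * (1 - U ξ))
      MeasureTheory.volume a b := Continuous.intervalIntegrable (by fun_prop) a b
  have h3 : IntervalIntegrable ({ξ | ε < U ξ}.indicator
      (fun ξ => k * U ξ * V ξ - U ξ * (1 - U ξ))) MeasureTheory.volume a b :=
    ⟨MeasureTheory.Integrable.indicator h2.1 hm, MeasureTheory.Integrable.indicator h2.2 hm⟩
  have he : (fun ξ => rhsV k c ε (U ξ) (V ξ)) = (fun ξ => -c * V ξ) +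
      {ξ | ε < U ξ}.indicator (fun ξ => k * U ξ * V ξ - U ξ * (1 - U ξ)) := by
    funext ξ
    by_cases hξ : ε < U ξ
    · have : 0 < U ξ - ε := by linarith
      simp [rhsV, heaviside, this, hξ]; ring
    · have : ¬ 0 < U ξ - ε := by linarith
      simp [rhsV, heaviside, this, hξ]
  rw [he]
  exact h1.add h3

/-- An orbit that stays in the strip for all backward times, continued by the explicit
exponential solution of the linear system, is a heteroclinic connection. -/
lemma hasHeteroclinic_of_forall_isOrbitOn {k c ε : ℝ} {u p : ℝ → ℝ} (hk : 0 ≤ k) (hc : 0 < c)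
    (hε : 0 < ε) (h : ∀ T, IsOrbitOn k c ε T u p) : HasHeteroclinic k c ε := by
  obtain ⟨hulim, hplim⟩ := tendsto_of_forall_isOrbitOn hk hc.le hε h
  have hu0 : u 0 = ε := (h 0).u_zero
  have hp0 : p 0 = c * ε := (h 0).p_zero
  have hp : ∀ s ≥ 0, 0 < p s := fun s hs => (h (s + 1)).p_pos s ⟨hs, by linarith⟩
  have hud : ∀ s ≥ 0, HasDerivAt u (p s) s := fun s hs => (h s).hasDerivAt_u s ⟨hs, le_rfl⟩
  have hpd : ∀ s ≥ 0, HasDerivAt p ((c - k * u s) * p s - u s * (1 - u s)) s :=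
    fun s hs => (h s).hasDerivAt_p s ⟨hs, le_rfl⟩
  have huε : ∀ s > 0, ε < u s := by
    intro s hs
    rw [← hu0]
    exact lt_of_hasDerivAt_pos hs (h s).continuousOn_u (fun r hr => hud r hr.1.le)
      (fun r hr => hp r hr.1.le)
  have hneg : ∀ s, HasDerivAt (fun s : ℝ => -s) (-1) s := fun s => hasDerivAt_neg s
  set e : ℝ → ℝ := fun ξ => ε * Real.exp (-(c * ξ)) with he
  have hed : ∀ ξ, HasDerivAt e (-c * e ξ) ξ := by
    intro ξ
    convert! ((((hasDerivAt_id ξ).const_mul c).neg).exp).const_mul ε using 1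
    simp [he]; ring
  set U : ℝ → ℝ := fun ξ => if ξ ≤ 0 then u (-ξ) else e ξ with hU
  set V : ℝ → ℝ := fun ξ => if ξ ≤ 0 then -p (-ξ) else -c * e ξ with hV
  have hVc : Continuous V := by
    refine continuous_if_le continuous_id continuous_const ?_ ?_ ?_
    · intro ξ hξ
      have hξ' : (0 : ℝ) ≤ -ξ := neg_nonneg.2 hξ
      exact (((hpd _ hξ').continuousAt.comp (x := ξ) (f := fun ξ => -ξ)
        continuous_neg.continuousAt).neg).continuousWithinAt
    · exact (by fun_prop : Continuous fun ξ => -c * e ξ).continuousOn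
    · rintro ξ (rfl : ξ = 0)
      simp [hp0, he]
  have hUd : ∀ ξ, HasDerivAt U (V ξ) ξ := by
    intro ξ
    rcases lt_trichotomy ξ 0 with hξ | rfl | hξ
    · have h1 := (hud (-ξ) (by linarith)).comp ξ (hneg ξ)
      have hv : V ξ = p (-ξ) * -1 := by simp [hV, hξ.le]
      rw [hv]
      refine h1.congr_of_eventuallyEq ?_
      filter_upwards [Iio_mem_nhds hξ] with x hx
      exact if_pos (le_of_lt hx)
    · have h1 := (hud (-0) (by simp)).comp (0 : ℝ) (hneg 0)
      refine hasDerivAt_ite_le (f := fun ξ => u (-ξ)) (g := e) (by simp [hu0, he]) ?_ ?_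
      · convert! h1 using 1
        simp [hV]
      · convert! hed 0 using 1
        simp [hV, he, hp0]
    · have hv : V ξ = -c * e ξ := by simp [hV, hξ.not_ge]
      rw [hv]
      refine (hed ξ).congr_of_eventuallyEq ?_
      filter_upwards [Ioi_mem_nhds hξ] with x hx
      exact if_neg (not_le.2 hx)
  have hUc : Continuous U := continuous_iff_continuousAt.2 fun s => (hUd s).continuousAt
  have hVd : ∀ ξ ≠ 0, HasDerivAt V (rhsV k c ε (U ξ) (V ξ)) ξ := by
    intro ξ hξ0
    rcases lt_or_gt_of_ne hξ0 with hξ | hξ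
    · have h1 := ((hpd (-ξ) (by linarith)).comp ξ (hneg ξ)).neg
      have hv : V ξ = -p (-ξ) := by simp [hV, hξ.le]
      have hu' : U ξ = u (-ξ) := by simp [hU, hξ.le]
      have hpos : 0 < u (-ξ) - ε := by linarith [huε (-ξ) (by linarith)]
      have hr : rhsV k c ε (U ξ) (V ξ)
          = -(((c - k * u (-ξ)) * p (-ξ) - u (-ξ) * (1 - u (-ξ))) * -1) := by
        rw [hv, hu']; simp only [rhsV, heaviside, hpos, if_true]; ring
      rw [hr]
      refine h1.congr_of_eventuallyEq ?_
      filter_upwards [Iio_mem_nhds hξ] with x hx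
      exact if_pos (le_of_lt hx)
    · have hv : V ξ = -c * e ξ := by simp [hV, hξ.not_ge]
      have hu' : U ξ = e ξ := by simp [hU, hξ.not_ge]
      have hpos : ¬ 0 < e ξ - ε := by
        have : Real.exp (-(c * ξ)) ≤ 1 := by
          rw [Real.exp_le_one_iff]; have := mul_pos hc hξ; linarith
        have := mul_le_mul_of_nonneg_left this hε.le
        simp only [he]; linarith
      have hr : rhsV k c ε (U ξ) (V ξ) = -c * (-c * e ξ) := by
        rw [hv, hu']; simp only [rhsV, heaviside, hpos, if_false]; ring
      rw [hr]
      refine ((hed ξ).const_mul (-c)).congr_of_eventuallyEq ?_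
      filter_upwards [Ioi_mem_nhds hξ] with x hx
      exact if_neg (not_le.2 hx)
  refine ⟨U, V, ⟨hVc, hUd, fun a b => ?_⟩, ?_, ?_⟩
  · exact (MeasureTheory.integral_eq_of_hasDerivAt_off_countable V _ (countable_singleton 0)
      hVc.continuousOn (fun x hx => hVd x hx.2) (intervalIntegrable_rhsV hUc hVc a b)).symm
  · rw [nhds_prod_eq]
    refine Tendsto.prodMk ?_ ?_
    · refine (hulim.comp tendsto_neg_atBot_atTop).congr' ?_
      filter_upwards [eventually_le_atBot 0] with x hx
      exact (if_pos hx).symm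
    · have := (hplim.comp tendsto_neg_atBot_atTop).neg
      rw [neg_zero] at this
      refine this.congr' ?_
      filter_upwards [eventually_le_atBot 0] with x hx
      exact (if_pos hx).symm
  · have hel : Tendsto e atTop (𝓝 0) := by
      have : Tendsto (fun ξ : ℝ => -(c * ξ)) atTop atBot :=
        tendsto_neg_atTop_atBot.comp (tendsto_id.const_mul_atTop hc)
      simpa using (Real.tendsto_exp_atBot.comp this).const_mul ε
    rw [nhds_prod_eq]
    refine Tendsto.prodMk ?_ ?_
    · refine hel.congr' ?_
      filter_upwards [eventually_gt_atTop 0] with x hx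
      exact (if_neg (not_le.2 hx)).symm
    · have := hel.const_mul (-c)
      rw [mul_zero] at this
      refine this.congr' ?_
      filter_upwards [eventually_gt_atTop 0] with x hx
      exact (if_neg (not_le.2 hx)).symm

/-! ### Global solutions of bounded Lipschitz systems -/

/-- An autonomous ODE with a bounded, globally Lipschitz right-hand side has global solutions. -/
lemma exists_forall_hasDerivAt_of_lipschitz {E : Type*} [NormedAddCommGroup E] [NormedSpace ℝ E]
    [CompleteSpace E] {F : E → E} {K L : NNReal} (hK : LipschitzWith K F) (hL : ∀ x, ‖F x‖ ≤ L)
    (x₀ : E) : ∃ z : ℝ → E, z 0 = x₀ ∧ ∀ t, HasDerivAt z (F (z t)) t := by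
  have loc : ∀ n : ℕ, ∃ z : ℝ → E, z 0 = x₀ ∧
      ∀ t ∈ Ioo (-((n : ℝ) + 1)) (n + 1), HasDerivAt z (F (z t)) t := by
    intro n
    have hn : (0 : ℝ) ≤ n := n.cast_nonneg
    have hPL : IsPicardLindelof (fun _ => F) (tmin := -((n : ℝ) + 1)) (tmax := n + 1)
        ⟨0, by constructor <;> linarith⟩ x₀ (L * (n + 1)) 0 L K :=
      IsPicardLindelof.of_time_independent (fun x _ => hL x) hK.lipschitzOnWith (by simp)
    obtain ⟨z, hz0, hz⟩ := hPL.exists_eq_forall_mem_Icc_hasDerivWithinAt₀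
    exact ⟨z, hz0, fun t ht =>
      (hz t (Ioo_subset_Icc_self ht)).hasDerivAt (Icc_mem_nhds ht.1 ht.2)⟩
  choose z hz0 hz using loc
  have hagree : ∀ m n : ℕ, m ≤ n → ∀ t ∈ Ioo (-((m : ℝ) + 1)) (m + 1), z m t = z n t := by
    intro m n hmn
    have hmn' : (m : ℝ) ≤ n := Nat.cast_le.2 hmn
    have hm : (0 : ℝ) ≤ m := m.cast_nonneg
    exact ODE_solution_unique_of_mem_Ioo (v := fun _ => F) (s := fun _ => univ)
      (t₀ := 0) (fun _ _ => hK.lipschitzOnWith) (by constructor <;> linarith)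
      (fun t ht => ⟨hz m t ht, mem_univ _⟩)
      (fun t ht => ⟨hz n t ⟨by linarith [ht.1], by linarith [ht.2]⟩, mem_univ _⟩)
      ((hz0 m).trans (hz0 n).symm)
  refine ⟨fun t => z ⌈|t|⌉₊ t, by simp [hz0], fun t => ?_⟩
  set N := ⌈|t|⌉₊ + 1 with hN
  have hloc : ∀ s : ℝ, |s| < N → z ⌈|s|⌉₊ s = z N s := by
    intro s hs
    refine hagree _ _ (Nat.ceil_le.2 hs.le) s ?_
    have := Nat.le_ceil |s|
    exact abs_lt.1 (by linarith)
  have htN : |t| < N := by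
    have := Nat.le_ceil |t|
    rw [hN]; push_cast; linarith
  beta_reduce
  rw [hloc t htN]
  refine (hz N t (abs_lt.1 (by linarith))).congr_of_eventuallyEq ?_
  filter_upwards [(isOpen_lt continuous_abs continuous_const).mem_nhds htN] with s hs
  exact hloc s hs

/-! ### The truncated system -/

/-- Truncation of a real number to the interval `[0, M]`. -/
noncomputable def clamp (M x : ℝ) : ℝ := max 0 (min x M)

lemma clamp_nonneg (M x : ℝ) : 0 ≤ clamp M x := le_max_left _ _

lemma clamp_le {M : ℝ} (hM : 0 ≤ M) (x : ℝ) : clamp M x ≤ M := max_le hM (min_le_right _ _)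

lemma clamp_eq {M x : ℝ} (h0 : 0 ≤ x) (h1 : x ≤ M) : clamp M x = x := by
  rw [clamp, min_eq_left h1, max_eq_right h0]

lemma abs_clamp_sub_le (M x y : ℝ) : |clamp M x - clamp M y| ≤ |x - y| := by
  refine (abs_max_sub_max_le_max _ _ _ _).trans ?_
  rw [sub_self, abs_zero, max_eq_right (abs_nonneg _)]
  refine (abs_min_sub_min_le_max _ _ _ _).trans ?_
  rw [sub_self, abs_zero, max_eq_left (abs_nonneg _)]

/-- The vector field `(u, p) ↦ (p, (c - k u) p - u (1 - u))` of the system in backward time, with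
`u` truncated to `[0, 1]` and `p` to `[0, M]`. This makes it bounded and globally Lipschitz. -/
noncomputable def truncField (k M c : ℝ) (z : ℝ × ℝ) : ℝ × ℝ :=
  (clamp M z.2, (c - k * clamp 1 z.1) * clamp M z.2 - clamp 1 z.1 * (1 - clamp 1 z.1))

lemma lipschitzWith_truncField {k M c : ℝ} (hk : 0 ≤ k) (hc : c ∈ Icc 0 M) :
    LipschitzWith (M + k * (1 + M) + 2).toNNReal (truncField k M c) := by
  have hM : 0 ≤ M := hc.1.trans hc.2
  have hK : 0 ≤ M + k * (1 + M) + 2 := by positivity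
  refine LipschitzWith.of_dist_le_mul fun z w => ?_
  rw [Real.coe_toNNReal _ hK]
  have h1 : |z.1 - w.1| ≤ dist z w := le_max_left _ _
  have h2 : |z.2 - w.2| ≤ dist z w := le_max_right _ _
  have h0 : 0 ≤ dist z w := dist_nonneg
  have a1 := (abs_clamp_sub_le 1 z.1 w.1).trans h1
  have a2 := (abs_clamp_sub_le M z.2 w.2).trans h2
  have b1 := clamp_nonneg 1 z.1
  have b2 := clamp_le zero_le_one z.1
  have b3 := clamp_nonneg 1 w.1
  have b4 := clamp_le zero_le_one w.1
  have b5 := clamp_nonneg M w.2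
  have b6 := clamp_le hM w.2
  rw [Prod.dist_eq, max_le_iff, Real.dist_eq, Real.dist_eq]
  simp only [truncField]
  generalize clamp 1 z.1 = x at *
  generalize clamp 1 w.1 = x' at *
  generalize clamp M z.2 = y at *
  generalize clamp M w.2 = y' at *
  generalize dist z w = d at *
  constructor
  · have : 0 ≤ (M + k * (1 + M) + 1) * d := by positivity
    linarith
  · have e : (c - k * x) * y - x * (1 - x) - ((c - k * x') * y' - x' * (1 - x'))
        = c * (y - y') - k * (x * (y - y') + y' * (x - x')) - (x - x') * (1 - x - x') := by ring
    rw [e]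
    have i1 : |c * (y - y')| ≤ M * d := by
      rw [abs_mul, abs_of_nonneg hc.1]
      exact mul_le_mul hc.2 a2 (abs_nonneg _) hM
    have i2 : |x * (y - y')| ≤ 1 * d := by
      rw [abs_mul, abs_of_nonneg b1]
      exact mul_le_mul b2 a2 (abs_nonneg _) zero_le_one
    have i3 : |y' * (x - x')| ≤ M * d := by
      rw [abs_mul, abs_of_nonneg b5]
      exact mul_le_mul b6 a1 (abs_nonneg _) hM
    have i4 : |k * (x * (y - y') + y' * (x - x'))| ≤ k * (1 * d + M * d) := by
      rw [abs_mul, abs_of_nonneg hk]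
      exact mul_le_mul_of_nonneg_left ((abs_add_le _ _).trans (add_le_add i2 i3)) hk
    have i5 : |(x - x') * (1 - x - x')| ≤ d * 1 := by
      rw [abs_mul]
      exact mul_le_mul a1 (abs_le.2 ⟨by linarith, by linarith⟩) (abs_nonneg _) h0
    have i6 := abs_sub (c * (y - y') - k * (x * (y - y') + y' * (x - x')))
      ((x - x') * (1 - x - x'))
    have i7 := abs_sub (c * (y - y')) (k * (x * (y - y') + y' * (x - x')))
    linarith

lemma norm_truncField_le {k M c : ℝ} (hk : 0 ≤ k) (hc : c ∈ Icc 0 M) (z : ℝ × ℝ) :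
    ‖truncField k M c z‖ ≤ (M + (M + k) * M + 1).toNNReal := by
  have hM : 0 ≤ M := hc.1.trans hc.2
  rw [Real.coe_toNNReal _ (by positivity)]
  have b1 := clamp_nonneg 1 z.1
  have b2 := clamp_le zero_le_one z.1
  have b5 := clamp_nonneg M z.2
  have b6 := clamp_le hM z.2
  have hkM : 0 ≤ (M + k) * M := by positivity
  rw [Prod.norm_def, max_le_iff]
  simp only [truncField, Real.norm_eq_abs]
  generalize clamp 1 z.1 = x at *
  generalize clamp M z.2 = y at *
  constructor
  · rw [abs_of_nonneg b5]; linarith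
  · have i1 : |(c - k * x) * y| ≤ (M + k) * M := by
      have hkx : 0 ≤ k * x := by positivity
      have hkx' : k * x ≤ k * 1 := by gcongr
      rw [abs_mul, abs_of_nonneg b5]
      exact mul_le_mul (abs_le.2 ⟨by linarith [hc.1], by linarith [hc.2]⟩) b6 b5 (by positivity)
    have i2 : |x * (1 - x)| ≤ 1 * 1 := by
      rw [abs_mul, abs_of_nonneg b1]
      exact mul_le_mul b2 (abs_le.2 ⟨by linarith, by linarith⟩) (abs_nonneg _) zero_le_one
    have := abs_sub ((c - k * x) * y) (x * (1 - x))
    linarith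

lemma dist_truncField_le {k M : ℝ} (hM : 0 ≤ M) (c c' : ℝ) (z : ℝ × ℝ) :
    dist (truncField k M c z) (truncField k M c' z) ≤ |c - c'| * M := by
  have b5 := clamp_nonneg M z.2
  have b6 := clamp_le hM z.2
  rw [Prod.dist_eq, max_le_iff, Real.dist_eq, Real.dist_eq]
  simp only [truncField, sub_self, abs_zero]
  constructor
  · positivity
  · have e : (c - k * clamp 1 z.1) * clamp M z.2 - clamp 1 z.1 * (1 - clamp 1 z.1)
        - ((c' - k * clamp 1 z.1) * clamp M z.2 - clamp 1 z.1 * (1 - clamp 1 z.1))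
        = (c - c') * clamp M z.2 := by ring
    rw [e, abs_mul, abs_of_nonneg b5]
    gcongr

/-- The truncated solutions starting at `(ε, c ε)`, and their Lipschitz dependence on `c`. The
speed is truncated as well, so that it may range over all of `ℝ`. -/
lemma exists_truncFlow {k M ε : ℝ} (hk : 0 ≤ k) (hM : 0 ≤ M) (hε : 0 ≤ ε) :
    ∃ z : ℝ → ℝ → ℝ × ℝ,
      (∀ c ∈ Icc 0 M, z c 0 = (ε, c * ε) ∧
        ∀ t, HasDerivAt (z c) (truncField k M c (z c t)) t) ∧
      (∀ c, Continuous (z c)) ∧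
      ∀ T, 0 ≤ T → ∃ C > 0, ∀ c c' : ℝ, ∀ t ∈ Icc 0 T, dist (z c t) (z c' t) ≤ |c - c'| * C := by
  have hcl : ∀ c, clamp M c ∈ Icc 0 M := fun c => ⟨clamp_nonneg M c, clamp_le hM c⟩
  have hex : ∀ c, ∃ z : ℝ → ℝ × ℝ, z 0 = (ε, clamp M c * ε) ∧
      ∀ t, HasDerivAt z (truncField k M (clamp M c) (z t)) t := fun c =>
    exists_forall_hasDerivAt_of_lipschitz (lipschitzWith_truncField hk (hcl c))
      (norm_truncField_le hk (hcl c)) _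
  choose z hz0 hz using hex
  have hKpos : 0 < M + k * (1 + M) + 2 := by positivity
  set K := M + k * (1 + M) + 2 with hK
  refine ⟨z, fun c hc => ?_,
    fun c => continuous_iff_continuousAt.2 fun t => (hz c t).continuousAt, fun T hT => ?_⟩
  · have := hz0 c
    have h2 := hz c
    rw [clamp_eq hc.1 hc.2] at this h2
    exact ⟨this, h2⟩
  have h1 : 0 ≤ Real.exp (K * T) - 1 := by
    have := Real.one_le_exp (mul_nonneg hKpos.le hT)
    linarith
  refine ⟨ε * Real.exp (K * T) + M / K * (Real.exp (K * T) - 1) + 1, by positivity, ?_⟩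
  intro c c' t ht
  have hcc := abs_clamp_sub_le M c c'
  have hcont : ∀ c, ContinuousOn (z c) (Icc 0 T) := fun c s _ =>
    (hz c s).continuousAt.continuousWithinAt
  have hg := dist_le_of_approx_trajectories_ODE (v := fun _ => truncField k M (clamp M c))
    (a := 0) (b := T) (εf := 0) (εg := |c - c'| * M) (δ := |c - c'| * ε)
    (f := z c) (g := z c')
    (fun _ => lipschitzWith_truncField hk (hcl c)) (hcont c)
    (fun s _ => (hz c s).hasDerivWithinAt) (fun s _ => by rw [dist_self]) (hcont c')
    (fun s _ => (hz c' s).hasDerivWithinAt)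
    (fun s _ => by
      rw [dist_comm]
      refine (dist_truncField_le hM _ _ _).trans ?_
      gcongr)
    (by
      rw [hz0, hz0, Prod.dist_eq, dist_self, Real.dist_eq, ← sub_mul, abs_mul, abs_of_nonneg hε]
      exact max_le (by positivity) (by gcongr)) t ht
  refine hg.trans ?_
  rw [Real.coe_toNNReal _ hKpos.le]
  refine (gronwallBound_mono (by positivity) (by positivity) hKpos.le
    (by linarith [ht.2] : t - 0 ≤ T)).trans ?_
  rw [gronwallBound_of_K_ne_0 hKpos.ne']
  beta_reduce
  have h3 : 0 ≤ |c - c'| := abs_nonneg _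
  have e : |c - c'| * ε * Real.exp (K * T) + (0 + |c - c'| * M) / K * (Real.exp (K * T) - 1)
      = |c - c'| * (ε * Real.exp (K * T) + M / K * (Real.exp (K * T) - 1)) := by ring
  rw [e]
  exact mul_le_mul_of_nonneg_left (by linarith) h3

/-! ### Shooting in the speed -/

/-- A solution of the truncated system starting at `(ε, c ε)` solves the original system on any
time interval on which it stays in the strip: there `ε ≤ u ≤ 1` because `u` is nondecreasing, and
`p ≤ c u ≤ M` because `p - c u` is nonincreasing. -/
lemma isOrbitOn_of_truncField {k M c ε T : ℝ} {z : ℝ → ℝ × ℝ} (hk : 0 ≤ k) (hc : c ∈ Icc 0 M)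
    (hε : 0 ≤ ε) (hT : 0 < T) (hz0 : z 0 = (ε, c * ε))
    (hz : ∀ t, HasDerivAt z (truncField k M c (z t)) t)
    (hpos : ∀ s ∈ Ico 0 T, 0 < (z s).2) (hle : ∀ s ∈ Ico 0 T, (z s).1 ≤ 1) :
    IsOrbitOn k c ε T (fun s => (z s).1) (fun s => (z s).2) := by
  have hu : ∀ s, HasDerivAt (fun s => (z s).1) (clamp M (z s).2) s := fun s => (hz s).fst
  have hp : ∀ s, HasDerivAt (fun s => (z s).2) ((c - k * clamp 1 (z s).1) * clamp M (z s).2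
      - clamp 1 (z s).1 * (1 - clamp 1 (z s).1)) s := fun s => (hz s).snd
  have huc : Continuous fun s => (z s).1 :=
    continuous_iff_continuousAt.2 fun s => (hu s).continuousAt
  have hpc : Continuous fun s => (z s).2 :=
    continuous_iff_continuousAt.2 fun s => (hp s).continuousAt
  have hcl : ∀ {f : ℝ → ℝ} {S : Set ℝ}, Continuous f → IsClosed S →
      (∀ s ∈ Ico 0 T, f s ∈ S) → ∀ s ∈ Icc 0 T, f s ∈ S := by
    intro f S hf hS h s hs
    have : closure (Ico 0 T) ⊆ f ⁻¹' S := closure_minimal h (hS.preimage hf)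
    rw [closure_Ico hT.ne] at this
    exact this hs
  have hpos' : ∀ s ∈ Icc 0 T, 0 ≤ (z s).2 :=
    hcl hpc isClosed_Ici fun s hs => (hpos s hs).le
  have hle' : ∀ s ∈ Icc 0 T, (z s).1 ≤ 1 := hcl huc isClosed_Iic hle
  have hu0 : ∀ s ∈ Icc 0 T, 0 ≤ (z s).1 := by
    intro s hs
    have := le_of_hasDerivAt_nonneg hs.1 huc.continuousOn (fun r _ => hu r)
      (fun r _ => clamp_nonneg M _)
    rw [hz0] at this
    exact hε.trans this
  have hpM : ∀ s ∈ Icc 0 T, (z s).2 ≤ M := by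
    intro s hs
    have := le_of_hasDerivAt_nonneg (f := fun s => c * (z s).1 - (z s).2) hs.1
      (by fun_prop) (fun r _ => ((hu r).const_mul c).sub (hp r)) (fun r _ => by
        have h1 := clamp_nonneg 1 (z r).1
        have h2 := clamp_le zero_le_one (z r).1
        have h3 := clamp_nonneg M (z r).2
        have h4 : 0 ≤ k * clamp 1 (z r).1 * clamp M (z r).2 := by positivity
        have h5 : 0 ≤ clamp 1 (z r).1 * (1 - clamp 1 (z r).1) :=
          mul_nonneg h1 (by linarith)
        linarith)
    simp only [hz0, sub_self] at this
    have h6 : c * (z s).1 ≤ c * 1 := mul_le_mul_of_nonneg_left (hle' s hs) hc.1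
    linarith [hc.2]
  refine ⟨by simp [hz0], by simp [hz0], fun s hs => ?_, fun s hs => ?_, hpos, hle'⟩
  · have := hu s
    rwa [clamp_eq (hpos' s hs) (hpM s hs)] at this
  · have := hp s
    rwa [clamp_eq (hpos' s hs) (hpM s hs), clamp_eq (hu0 s hs) (hle' s hs)] at this

/-- The trajectory `z` crosses `p = 0` before `u` reaches `1`. -/
def ExitsBelow (z : ℝ → ℝ × ℝ) : Prop := ∃ s ≥ 0, (z s).2 < 0 ∧ ∀ t ∈ Icc 0 s, (z t).1 < 1

/-- The trajectory `z` crosses `u = 1` before `p` reaches `0`. -/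
def ExitsRight (z : ℝ → ℝ × ℝ) : Prop := ∃ s ≥ 0, 1 < (z s).1 ∧ ∀ t ∈ Icc 0 s, 0 < (z t).2

lemma ExitsBelow.not_exitsRight {z : ℝ → ℝ × ℝ} (h : ExitsBelow z) : ¬ ExitsRight z := by
  rintro ⟨t, ht, ht1, ht2⟩
  obtain ⟨s, hs, hs1, hs2⟩ := h
  rcases le_total s t with hst | hst
  · linarith [ht2 s ⟨hs, hst⟩]
  · linarith [hs2 t ⟨ht, hst⟩]

/-- A trajectory of the truncated system either stays in the strip for ever, or leaves it through
`p = 0`, or leaves it through `u = 1`. It cannot leave through the corner, which is an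
equilibrium. -/
lemma truncField_trichotomy {k M c ε : ℝ} {z : ℝ → ℝ × ℝ} (hk : 0 ≤ k) (hc0 : 0 < c)
    (hcM : c ≤ M) (hε : 0 < ε) (hε1 : ε < 1) (hz0 : z 0 = (ε, c * ε))
    (hz : ∀ t, HasDerivAt z (truncField k M c (z t)) t) :
    (∀ T, IsOrbitOn k c ε T (fun s => (z s).1) (fun s => (z s).2)) ∨
    ∃ T > 0, IsOrbitOn k c ε T (fun s => (z s).1) (fun s => (z s).2) ∧
      ((z T).2 = 0 ∧ ExitsBelow z ∨ (z T).1 = 1 ∧ 0 < (z T).2 ∧ ExitsRight z) := by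
  have hu : ∀ s, HasDerivAt (fun s => (z s).1) (clamp M (z s).2) s := fun s => (hz s).fst
  have hp : ∀ s, HasDerivAt (fun s => (z s).2) ((c - k * clamp 1 (z s).1) * clamp M (z s).2
      - clamp 1 (z s).1 * (1 - clamp 1 (z s).1)) s := fun s => (hz s).snd
  have huc : Continuous fun s => (z s).1 :=
    continuous_iff_continuousAt.2 fun s => (hu s).continuousAt
  have hpc : Continuous fun s => (z s).2 :=
    continuous_iff_continuousAt.2 fun s => (hp s).continuousAt
  have hmono : ∀ a b, a ≤ b → (z a).1 ≤ (z b).1 := fun a b hab =>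
    le_of_hasDerivAt_nonneg hab huc.continuousOn (fun r _ => hu r) (fun r _ => clamp_nonneg M _)
  have hf0 : 0 < min (z 0).2 (1 - (z 0).1) := by
    rw [hz0]
    exact lt_min (by positivity) (by linarith)
  by_cases hstay : ∀ s ≥ 0, 0 < min (z s).2 (1 - (z s).1)
  · left
    intro T
    have h := isOrbitOn_of_truncField (T := max T 1) hk ⟨hc0.le, hcM⟩ hε.le (by positivity) hz0 hz
      (fun s hs => (lt_min_iff.1 (hstay s hs.1)).1)
      (fun s hs => by linarith [(lt_min_iff.1 (hstay s hs.1)).2])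
    have hTT : T ≤ max T 1 := le_max_left _ _
    exact ⟨h.u_zero, h.p_zero, fun s hs => h.hasDerivAt_u s ⟨hs.1, hs.2.trans hTT⟩,
      fun s hs => h.hasDerivAt_p s ⟨hs.1, hs.2.trans hTT⟩,
      fun s hs => h.p_pos s ⟨hs.1, hs.2.trans_le hTT⟩,
      fun s hs => h.u_le_one s ⟨hs.1, hs.2.trans hTT⟩⟩
  · right
    push Not at hstay
    obtain ⟨b, hb, hfb⟩ := hstay
    obtain ⟨T, hT, hfT, hlt⟩ := exists_first_zero (f := fun s => min (z s).2 (1 - (z s).1))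
      (by fun_prop) hb hf0 hfb
    have h := isOrbitOn_of_truncField hk ⟨hc0.le, hcM⟩ hε.le hT.1 hz0 hz
      (fun s hs => (lt_min_iff.1 (hlt s hs)).1)
      (fun s hs => by linarith [(lt_min_iff.1 (hlt s hs)).2])
    refine ⟨T, hT.1, h, ?_⟩
    have hTmem : T ∈ Icc 0 T := ⟨hT.1.le, le_rfl⟩
    have hεT : ε ≤ (z T).1 := h.le_u hTmem
    have hpT : 0 ≤ (z T).2 := hfT ▸ min_le_left _ _
    have huT : (z T).1 ≤ 1 := h.u_le_one T hTmem
    rcases hpT.eq_or_lt with hp0 | hp0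
    · rcases huT.eq_or_lt with hu1 | hu1
      · exfalso
        have := eq_one_of_reaches_equilibrium hk hc0.le hT.1.le huc.continuousOn hpc.continuousOn
          (fun s hs => h.hasDerivAt_u s (Ioo_subset_Icc_self hs))
          (fun s hs => h.hasDerivAt_p s (Ioo_subset_Icc_self hs))
          (fun s hs => ⟨hε.le.trans (h.le_u (Ioo_subset_Icc_self hs)),
            h.u_le_one s (Ioo_subset_Icc_self hs)⟩)
          (fun s hs => (h.p_pos s ⟨hs.1.le, hs.2⟩).le) hu1 hp0.symm
        rw [hz0] at this
        exact hε1.ne this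
      · left
        refine ⟨hp0.symm, ?_⟩
        have hd := h.hasDerivAt_p T hTmem
        have hneg : (c - k * (z T).1) * (z T).2 - (z T).1 * (1 - (z T).1) < 0 := by
          rw [← hp0]
          have : 0 < (z T).1 * (1 - (z T).1) := mul_pos (by linarith) (by linarith)
          linarith
        obtain ⟨r, ⟨hr, hr1⟩, hrT⟩ :=
          (((eventually_sign_of_hasDerivAt_neg hd hneg hp0.symm).1.and
          ((huc.continuousAt.eventually (gt_mem_nhds hu1)).filter_mono
            nhdsWithin_le_nhds)).and self_mem_nhdsWithin).exists
        have hrT' : T < r := hrT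
        exact ⟨r, hT.1.le.trans hrT'.le, hr, fun t ht => (hmono t r ht.2).trans_lt hr1⟩
    · right
      have hu1 : (z T).1 = 1 := by
        rcases min_choice (z T).2 (1 - (z T).1) with h1 | h1
        · rw [h1] at hfT; linarith
        · rw [h1] at hfT; linarith
      refine ⟨hu1, hp0, ?_⟩
      have hd := (h.hasDerivAt_u T hTmem).const_sub 1
      have hev := (eventually_sign_of_hasDerivAt_neg hd (by linarith) (by linarith)).1
      obtain ⟨q, hq, hq'⟩ := (mem_nhdsGT_iff_exists_Ioo_subset).1
        ((hpc.continuousAt.eventually (lt_mem_nhds hp0)).filter_mono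
          (nhdsWithin_le_nhds (s := Ioi T)))
      obtain ⟨r, hr, hrT⟩ := (hev.and (Ioo_mem_nhdsGT hq)).exists
      refine ⟨r, hT.1.le.trans hrT.1.le, by linarith, fun t ht => ?_⟩
      rcases lt_trichotomy t T with h1 | h1 | h1
      · exact h.p_pos t ⟨ht.1, h1⟩
      · rw [h1]; exact hp0
      · exact hq' ⟨h1, ht.2.trans_lt hrT.2⟩

/-- Strict sign conditions at the end and along a compact piece of a trajectory persist under
small changes of the parameter. -/
lemma isOpen_setOf_exists_pos {f g : ℝ → ℝ → ℝ}
    (hg : ∀ c, Continuous (g c))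
    (hcl : ∀ T, 0 ≤ T → ∃ C > 0, ∀ c c' : ℝ, ∀ t ∈ Icc 0 T,
      |f c t - f c' t| ≤ |c - c'| * C ∧ |g c t - g c' t| ≤ |c - c'| * C) :
    IsOpen {c | ∃ s ≥ 0, 0 < f c s ∧ ∀ t ∈ Icc 0 s, 0 < g c t} := by
  refine Metric.isOpen_iff.2 ?_
  rintro c ⟨s, hs, hfs, hgs⟩
  obtain ⟨C, hC, hCl⟩ := hcl s hs
  obtain ⟨t₀, ht₀, hmin⟩ := isCompact_Icc.exists_isMinOn ⟨0, left_mem_Icc.2 hs⟩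
    (hg c).continuousOn
  have hm : 0 < min (f c s) (g c t₀) := lt_min hfs (hgs t₀ ht₀)
  refine ⟨min (f c s) (g c t₀) / C, by positivity, fun c' hc' => ?_⟩
  rw [Metric.mem_ball, dist_comm, Real.dist_eq, lt_div_iff₀ hC] at hc'
  obtain ⟨h1, h2⟩ := lt_min_iff.1 hc'
  refine ⟨s, hs, ?_, fun t ht => ?_⟩
  · have := (abs_le.1 (hCl c c' s ⟨hs, le_rfl⟩).1).2
    linarith
  · have h3 := (abs_le.1 (hCl c c' t ht).2).2
    have h4 : g c t₀ ≤ g c t := hmin ht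
    linarith

lemma exists_critical_parabola {k : ℝ} (hk : 0 < k) :
    ∃ a > 0, k ≤ 2 * a ∧ cCrit k = a + 1 / a := by
  rcases le_or_gt k 2 with hk2 | hk2
  · exact ⟨1, one_pos, by linarith, by rw [cCrit, if_pos hk2]; norm_num⟩
  · refine ⟨k / 2, by positivity, by linarith, ?_⟩
    rw [cCrit, if_neg hk2.not_ge]
    congr 1
    field_simp

lemma two_le_cCrit {k : ℝ} (hk : 0 < k) : 2 ≤ cCrit k := by
  obtain ⟨a, ha, -, h⟩ := exists_critical_parabola hk
  rw [h]
  have : a + 1 / a - 2 = (a - 1) ^ 2 / a := by field_simp; ring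
  have h2 : 0 ≤ (a - 1) ^ 2 / a := by positivity
  linarith

/-- For small cut-offs there is a heteroclinic connection with a speed just below the critical
one. The speeds whose trajectory leaves the strip through `p = 0`, and those whose trajectory
leaves it through `u = 1`, form disjoint open sets containing one end of the interval each, so
some speed in between belongs to neither. -/
lemma exists_hasHeteroclinic {k d : ℝ} (hk : 0 < k) (hd : 0 < d) (hd1 : d ≤ 1) :
    ∃ ε₀ > 0, ε₀ ≤ 1 / 2 ∧ ∀ ε, 0 < ε → ε < ε₀ →
      ∃ c ∈ Icc (cCrit k - d) (cCrit k), HasHeteroclinic k c ε := by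
  obtain ⟨b, ε₀, hε₀, hε₀2, hlow⟩ := exists_cutoff_forall_orbit_lt hk hd hd1
  refine ⟨ε₀, hε₀, hε₀2, fun ε hε hεε => ?_⟩
  have hε1 : ε < 1 := by linarith
  have hM2 := two_le_cCrit hk
  set M := cCrit k with hM
  have hM0 : 0 ≤ M := by linarith
  obtain ⟨z, hz, hzc, hlip⟩ := exists_truncFlow hk.le hM0 hε.le
  have hmem : ∀ c ∈ Icc (M - d) M, 0 < c ∧ c ∈ Icc 0 M := fun c hc =>
    ⟨by linarith [hc.1], by linarith [hc.1], hc.2⟩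
  by_contra! hcon
  have htri : ∀ c ∈ Icc (M - d) M, ∃ T > 0,
      IsOrbitOn k c ε T (fun s => (z c s).1) (fun s => (z c s).2) ∧
      ((z c T).2 = 0 ∧ ExitsBelow (z c) ∨ (z c T).1 = 1 ∧ 0 < (z c T).2 ∧ ExitsRight (z c)) := by
    intro c hc
    obtain ⟨hc0, hcM⟩ := hmem c hc
    refine (truncField_trichotomy hk.le hc0 hcM.2 hε hε1 (hz c hcM).1 (hz c hcM).2).resolve_left ?_
    intro hall
    exact hcon c hc (hasHeteroclinic_of_forall_isOrbitOn hk.le hc0 hε hall)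
  have hA : ExitsBelow (z (M - d)) := by
    obtain ⟨T, hT, horb, h | ⟨h1, h2, -⟩⟩ := htri (M - d) ⟨le_rfl, by linarith⟩
    · exact h.2
    · exfalso
      have := hlow ε hε hεε T _ _ hT.le horb (by rw [h1]; norm_num) h2.le
      rw [h1] at this
      linarith
  have hB : ExitsRight (z M) := by
    obtain ⟨T, hT, horb, ⟨h1, -⟩ | h⟩ := htri M ⟨by linarith, le_rfl⟩
    · exfalso
      obtain ⟨a, ha, hka, hMa⟩ := exists_critical_parabola hk
      have := horb.gap_ge hT.le hε ha hka hMa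
      rw [h1] at this
      have h2 := hε.le.trans (horb.le_u ⟨hT.le, le_rfl⟩)
      have h3 := horb.u_le_one T ⟨hT.le, le_rfl⟩
      have h4 : 0 ≤ a * ((z M T).1 * (1 - (z M T).1)) :=
        mul_nonneg ha.le (mul_nonneg h2 (by linarith))
      have h5 : 0 < ε / a := by positivity
      linarith
    · exact h.2.2
  have hfst : ∀ c c' t, |(z c t).1 - (z c' t).1| ≤ dist (z c t) (z c' t) := fun c c' t =>
    le_max_left _ _
  have hsnd : ∀ c c' t, |(z c t).2 - (z c' t).2| ≤ dist (z c t) (z c' t) := fun c c' t =>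
    le_max_right _ _
  have hAo : IsOpen {c | ExitsBelow (z c)} := by
    have := isOpen_setOf_exists_pos (f := fun c t => -(z c t).2) (g := fun c t => 1 - (z c t).1)
      (fun c => by have := hzc c; fun_prop) (fun T hT => by
        obtain ⟨C, hC, hCl⟩ := hlip T hT
        refine ⟨C, hC, fun c c' t ht => ⟨?_, ?_⟩⟩
        · rw [neg_sub_neg, abs_sub_comm]
          exact (hsnd c c' t).trans (hCl c c' t ht)
        · rw [sub_sub_sub_cancel_left, abs_sub_comm]
          exact (hfst c c' t).trans (hCl c c' t ht))
    simpa only [ExitsBelow, neg_pos, sub_pos] using this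
  have hBo : IsOpen {c | ExitsRight (z c)} := by
    have := isOpen_setOf_exists_pos (f := fun c t => (z c t).1 - 1) (g := fun c t => (z c t).2)
      (fun c => by have := hzc c; fun_prop) (fun T hT => by
        obtain ⟨C, hC, hCl⟩ := hlip T hT
        refine ⟨C, hC, fun c c' t ht => ⟨?_, ?_⟩⟩
        · rw [sub_sub_sub_cancel_right]
          exact (hfst c c' t).trans (hCl c c' t ht)
        · exact (hsnd c c' t).trans (hCl c c' t ht))
    simpa only [ExitsRight, sub_pos] using this
  obtain ⟨c, -, hcA, hcB⟩ := isPreconnected_Icc (a := M - d) (b := M) _ _ hAo hBo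
    (fun c hc => by
      obtain ⟨T, -, -, h | h⟩ := htri c hc
      · exact Or.inl h.2
      · exact Or.inr h.2.2)
    ⟨M - d, ⟨le_rfl, by linarith⟩, hA⟩ ⟨M, ⟨by linarith, le_rfl⟩, hB⟩
  exact hcA.not_exitsRight hcB

end BurgersFKPP

theorem mainTheorem2 (k : ℝ) (hk : 0 < k) (δ : ℝ) (hδ : 0 < δ) :
    ∃ ε₀ : ℝ, 0 < ε₀ ∧ ∀ ε : ℝ, 0 < ε → ε < ε₀ →
      ∃ c : ℝ, BurgersFKPP.HasHeteroclinic k c ε ∧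
        (∀ c' : ℝ, BurgersFKPP.HasHeteroclinic k c' ε → c' = c) ∧
        |c - BurgersFKPP.cCrit k| < δ ∧ c ≤ BurgersFKPP.cCrit k := by
  have hd : 0 < min (δ / 2) 1 := by positivity
  obtain ⟨ε₀, hε₀, hε₀2, hex⟩ := BurgersFKPP.exists_hasHeteroclinic hk hd (min_le_right _ _)
  refine ⟨ε₀, hε₀, fun ε hε hεε => ?_⟩
  have hε1 : ε < 1 := by linarith
  obtain ⟨c, hc, hhet⟩ := hex ε hε hεε
  refine ⟨c, hhet, fun c' hc' => ?_, ?_, hc.2⟩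
  · obtain ⟨u, p, h⟩ := hhet.exists_isFront hk.le hε hε1
    obtain ⟨u', p', h'⟩ := hc'.exists_isFront hk.le hε hε1
    exact le_antisymm (not_lt.1 (h.speed_not_lt h' hε)) (not_lt.1 (h'.speed_not_lt h hε))
  · have := min_le_left (δ / 2) (1 : ℝ)
    rw [abs_lt]
    constructor <;> linarith [hc.1, hc.2]
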